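/- **Setting.** Let $\mathcal J$ be a countable set (of sorts), let $\mathbb N$ be the set of positive integers, let $\mathcal J^{<\mathbb N}$ be the set of non-empty finite tuples from $\mathcal J$, and let $\Vert J\Vert$ be the set of entries of a tuple $J$. Fix a function $J^*_\subset:\mathbb N\times\mathcal J^{<\mathbb N}\to\mathcal J^{<\mathbb N}$. A *sorting data* on a profinite group $G$ assigns to each open normal subgroup $N$ of $G$ a non-empty set $F(N)\subset\mathcal J^{<\mathbb N}$ such that $F(G)=\mathcal J^{<\mathbb N}$; $J\in F(N)$ iff every $J'$ with $\Vert J\Vert\subset\Vert J'\Vert$ is in $F(N)$; $F(N)$ is closed under permuting tuples; if $N_1\subset N_2$, $[G:N_1]\le k$ and $J\in F(N_1)$, then $J^*_\subset(k,J)\in F(N_2)$; and if $J_i\in F(N_i)$ $(i=1,2)$, then the concatenation $J_1{}^\frown J_2$ is in $F(N_1\cap N_2)$. The many-sorted language $\mathcal L_G(\mathcal J)$ has a sort $m(k,J)$ for each $(k,J)\in\mathbb N\times\mathcal J^{<\mathbb N}$, binary relations $\le$ and $C$ on each $m(k,J)\times m(k',J')$, and a ternary relation $P$ on each $m(k,J)$.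 The *sorted complete system* $S(G,F)$ of a profinite group $G$ with sorting data $F$ is the structure in which $m(k,J)$ is the set of the cosets $gN$ (labelled by the sort) with $N$ open normal, $[G:N]\le k$ and $J\in F(N)$; $gN\le g'N'$ iff $N\subset N'$; $C(gN,g'N')$ iff $gN\subset g'N'$; and $P$ holds of $(g_1N,g_2N,g_1g_2N)$. The models of $SCS$ are the structures isomorphic to some $S(G,F)$. A *subsystem* of a structure is a substructure that is a model of $SCS$; for a set $X$ of elements, $S_X$ is the smallest subsystem of $S$ containing $X$; a subsystem is *finitely generated* if it is $S_X$ for a finite $X$. A model $S$ of $SCS$ has *co-SEP* if for all finitely generated subsystems $S_1,S_2$ of $S$ and all embeddings $\Pi:S_2\to S_1$ and $\Phi:S_2\to S$ there is an embedding $\Psi:S_1\to S$ with $\Psi\circ\Pi=\Phi$. The models of $SCS_{SEP}$ are the models of $SCS$ with co-SEP. For $a$ in $S$ let $[a]$ be its class for $x\le y\wedge y\le x$. For $a\in m(k,J)$ and a subsystem $A$ of $S$, let $a\vee A$ be the set of all $c\in m(kk',J^*_\subset(k,J))$ such that, for some $b\in A\cap m(k',J')$, $[c]=[a]\vee[b]$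 is the least of the joins $[a]\vee[b']$ with $b'\in A$. (If $A$ has a least class, this is the join of $[a]$ with that class.) **Theorem.** Let $S$ be a model of $SCS_{SEP}$. 1. Let $A$ be a subsystem of $S$ and let $a,b\in m(k,J)$ be elements of $S$. Then $\operatorname{tp}(a/A)=\operatorname{tp}(b/A)$ if and only if $a\vee A=b\vee A$ and there is an isomorphism $f:S_{(a\vee A)\cup\{a\}}\to S_{(b\vee A)\cup\{b\}}$ such that $f$ is the identity on $S_{a\vee A}$ and $f(a)=b$. 2. $\operatorname{Th}(S)$ is $\omega$-stable: for every model $M$ of $\operatorname{Th}(S)$, every countable set $A$ of elements of $M$ and every finite tuple of sorted variables, there are only countably many complete types over $A$ in these variables. -/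

import Mathlib

namespace SortedSystem

universe u

variable {𝒥 : Type u}

/-! ### Sorts and tuples of sorts -/

/-- Finite non-empty tuples of elements of `𝒥`. -/
def Tuple (𝒥 : Type u) : Type u := {l : List 𝒥 // l ≠ []}

namespace Tuple

/-- Concatenation of tuples. -/
def append (J J' : Tuple 𝒥) : Tuple 𝒥 :=
  ⟨J.1 ++ J'.1, by
    intro h
    exact J.2 (List.append_eq_nil_iff.mp h).1⟩

/-- The set of entries of a tuple. -/
def support (J : Tuple 𝒥) : Set 𝒥 := {j | j ∈ J.1}

/-- The tuples that involve at least the entries of `J`. -/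
def rad (J : Tuple 𝒥) : Set (Tuple 𝒥) := {J' | J.support ⊆ J'.support}

end Tuple

/-- The sorts `m(k, J)` of the language of sorted complete systems: pairs of a positive integer
and a non-empty finite tuple. -/
abbrev Idx (𝒥 : Type u) : Type u := ℕ+ × Tuple 𝒥

/-! ### Sorted profinite groups -/

/-- A sorting data on a profinite group `G`, relative to a function
`Jsub : ℕ+ → Tuple 𝒥 → Tuple 𝒥`: a non-empty set of tuples for each open normal subgroup.
(Invariance under inner automorphisms is automatic, since the subgroups are normal.) -/
structure SortingData (Jsub : ℕ+ → Tuple 𝒥 → Tuple 𝒥) (G : ProfiniteGrp.{u}) where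
  /-- the tuples attached to an open normal subgroup -/
  F : OpenNormalSubgroup G → Set (Tuple 𝒥)
  nonempty : ∀ N, (F N).Nonempty
  whole : ∀ N : OpenNormalSubgroup G, (N : Subgroup G) = ⊤ → F N = Set.univ
  rad_iff : ∀ N J, J ∈ F N ↔ J.rad ⊆ F N
  perm : ∀ N (J J' : Tuple 𝒥), J.1.Perm J'.1 → (J ∈ F N ↔ J' ∈ F N)
  mono : ∀ (N₁ N₂ : OpenNormalSubgroup G) (k : ℕ+) (J : Tuple 𝒥), N₁ ≤ N₂ →
    (N₁ : Subgroup G).index ≤ k → J ∈ F N₁ → Jsub k J ∈ F N₂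
  inter : ∀ (N₁ N₂ : OpenNormalSubgroup G) (J₁ J₂ : Tuple 𝒥),
    J₁ ∈ F N₁ → J₂ ∈ F N₂ → J₁.append J₂ ∈ F (N₁ ⊓ N₂)

/-! ### Structures for the language of sorted complete systems -/

/-- A many-sorted structure with sorts `m(k, J)`, binary relations `≤` and `C` on each
`m(k, J) × m(k', J')`, and a ternary relation `P` on each `m(k, J)`. -/
structure Str (𝒥 : Type u) where
  /-- the sort `m(k, J)` -/
  carrier : Idx 𝒥 → Type u
  /-- the relations `≤` -/
  le : ∀ {s t : Idx 𝒥}, carrier s → carrier t → Prop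
  /-- the relations `C` -/
  C : ∀ {s t : Idx 𝒥}, carrier s → carrier t → Prop
  /-- the relations `P` -/
  P : ∀ {s : Idx 𝒥}, carrier s → carrier s → carrier s → Prop

/-- All elements of a structure, of all sorts. -/
abbrev Str.Elem (M : Str 𝒥) : Type u := Σ s : Idx 𝒥, M.carrier s

/-- Embeddings of structures: injective in each sort, preserving and reflecting the relations. -/
structure Embedding (M N : Str 𝒥) where
  /-- the underlying map on each sort -/
  toFun : ∀ s, M.carrier s → N.carrier s
  injective : ∀ s, Function.Injective (toFun s)
  le_iff : ∀ {s t} (x : M.carrier s) (y : M.carrier t),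
    N.le (toFun s x) (toFun t y) ↔ M.le x y
  C_iff : ∀ {s t} (x : M.carrier s) (y : M.carrier t),
    N.C (toFun s x) (toFun t y) ↔ M.C x y
  P_iff : ∀ {s} (x y z : M.carrier s),
    N.P (toFun s x) (toFun s y) (toFun s z) ↔ M.P x y z

/-- Isomorphisms of structures. -/
structure Iso (M N : Str 𝒥) extends Embedding M N where
  surjective : ∀ s, Function.Surjective (toFun s)

/-- The substructure on a set of elements (the language is relational). -/
def Str.induce (M : Str 𝒥) (A : Set M.Elem) : Str 𝒥 where
  carrier s := {x : M.carrier s // (⟨s, x⟩ : M.Elem) ∈ A}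
  le x y := M.le x.1 y.1
  C x y := M.C x.1 y.1
  P x y z := M.P x.1 y.1 z.1

/-! ### Sorted complete systems -/

/-- The sorted complete system `S(G, F)` of a sorted profinite group: `m(k, J)` is the set of
cosets `gN` with `[G : N] ≤ k` and `J ∈ F(N)`; `≤` is `N ⊆ N'`; `C` is `gN ⊆ g'N'`; and `P` is
the graph of the multiplication of `G / N`. -/
def completeSystem {Jsub : ℕ+ → Tuple 𝒥 → Tuple 𝒥} (G : ProfiniteGrp.{u})
    (D : SortingData Jsub G) : Str 𝒥 where
  carrier s := Σ N : {N : OpenNormalSubgroup G // (N : Subgroup G).index ≤ s.1 ∧ s.2 ∈ D.F N},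
    G ⧸ (N.1 : Subgroup G)
  le x y := x.1.1 ≤ y.1.1
  C x y := {g : G | (QuotientGroup.mk g : G ⧸ (x.1.1 : Subgroup G)) = x.2} ⊆
    {g : G | (QuotientGroup.mk g : G ⧸ (y.1.1 : Subgroup G)) = y.2}
  P x y z := ∃ N, ∃ g₁ g₂ : G, x = ⟨N, QuotientGroup.mk g₁⟩ ∧ y = ⟨N, QuotientGroup.mk g₂⟩ ∧
    z = ⟨N, QuotientGroup.mk (g₁ * g₂)⟩

/-- Models of `SCS`, the theory of sorted complete systems: the structures isomorphic to
`S(G, F)` for a sorted profinite group `(G, F)`. -/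
def IsSCS (Jsub : ℕ+ → Tuple 𝒥 → Tuple 𝒥) (M : Str 𝒥) : Prop :=
  ∃ (G : ProfiniteGrp.{u}) (D : SortingData Jsub G), Nonempty (Iso (completeSystem G D) M)

/-- A subsystem: a substructure which is itself a model of `SCS`. -/
def IsSubsystem (Jsub : ℕ+ → Tuple 𝒥 → Tuple 𝒥) (M : Str 𝒥) (A : Set M.Elem) : Prop :=
  IsSCS Jsub (M.induce A)

/-- The subsystem `S_X` generated by `X`: the smallest subsystem containing `X`. -/
def gen (Jsub : ℕ+ → Tuple 𝒥 → Tuple 𝒥) (M : Str 𝒥) (X : Set M.Elem) : Set M.Elem :=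
  ⋂₀ {A | IsSubsystem Jsub M A ∧ X ⊆ A}

theorem subset_gen (Jsub : ℕ+ → Tuple 𝒥 → Tuple 𝒥) (M : Str 𝒥) (X : Set M.Elem) :
    X ⊆ gen Jsub M X :=
  Set.subset_sInter fun _ h => h.2

theorem gen_mono (Jsub : ℕ+ → Tuple 𝒥 → Tuple 𝒥) (M : Str 𝒥) {X Y : Set M.Elem} (h : X ⊆ Y) :
    gen Jsub M X ⊆ gen Jsub M Y :=
  Set.sInter_subset_sInter fun _ hA => ⟨hA.1, h.trans hA.2⟩

/-- Finitely generated subsystems. -/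
def IsFGSubsystem (Jsub : ℕ+ → Tuple 𝒥 → Tuple 𝒥) (M : Str 𝒥) (A : Set M.Elem) : Prop :=
  IsSubsystem Jsub M A ∧ ∃ X : Set M.Elem, X.Finite ∧ A = gen Jsub M X

/-- The co-sorted embedding property: for all finitely generated subsystems `S₁, S₂` of `M`, every
embedding `Φ : S₂ → M` factors through every embedding `Π : S₂ → S₁` by an embedding
`Ψ : S₁ → M`. -/
def CoSEP (Jsub : ℕ+ → Tuple 𝒥 → Tuple 𝒥) (M : Str 𝒥) : Prop :=
  ∀ S₁ S₂ : Set M.Elem, IsFGSubsystem Jsub M S₁ → IsFGSubsystem Jsub M S₂ →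
    ∀ (p : Embedding (M.induce S₂) (M.induce S₁)) (φ : Embedding (M.induce S₂) M),
      ∃ ψ : Embedding (M.induce S₁) M,
        ∀ s (x : (M.induce S₂).carrier s), ψ.toFun s (p.toFun s x) = φ.toFun s x

/-- Models of `SCS_SEP`: the sorted complete systems that have co-SEP. -/
def IsSCSSEP (Jsub : ℕ+ → Tuple 𝒥 → Tuple 𝒥) (M : Str 𝒥) : Prop :=
  IsSCS Jsub M ∧ CoSEP Jsub M

/-- The join `a ∨ A` of an element `a ∈ m(k, J)` with a subsystem `A`: the set of the
`c ∈ m(kk', Jsub k J)` such that, for some `b ∈ A ∩ m(k', J')`, `c` is an upper bound of `a` and `b`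
and lies below every common upper bound of `a` and any `b'` in `A`. That is, `[c] = [a] ∨ [b]` is
the least of all the joins `[a] ∨ [b']` with `b'` in `A`. When `A` has a least class, this is the
join of `[a]` with that class. -/
def joinSet (Jsub : ℕ+ → Tuple 𝒥 → Tuple 𝒥) (M : Str 𝒥) {k : ℕ+} {J : Tuple 𝒥}
    (a : M.carrier (k, J)) (A : Set M.Elem) : Set M.Elem :=
  {c | ∃ (k' : ℕ+) (J' : Tuple 𝒥) (b : M.carrier (k', J')),
    (⟨(k', J'), b⟩ : M.Elem) ∈ A ∧ c.1 = (k * k', Jsub k J) ∧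
    M.le a c.2 ∧ M.le b c.2 ∧
    ∀ b' ∈ A, ∀ d : M.Elem, M.le a d.2 → M.le b'.2 d.2 → M.le c.2 d.2}

/-! ### Many-sorted first-order logic -/

/-- Variables of sort `s` in a context (a list of sorts). -/
inductive Var : List (Idx 𝒥) → Idx 𝒥 → Type u
  | zero {Γ : List (Idx 𝒥)} {s : Idx 𝒥} : Var (s :: Γ) s
  | succ {Γ : List (Idx 𝒥)} {s t : Idx 𝒥} : Var Γ s → Var (t :: Γ) s

/-- Terms of sort `s`: variables from `Γ` and constant symbols from `K`. -/
inductive Term (K : Idx 𝒥 → Type u) (Γ : List (Idx 𝒥)) (s : Idx 𝒥) : Type u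
  | var : Var Γ s → Term K Γ s
  | const : K s → Term K Γ s

/-- First-order formulas with free variables from a context, in the language of sorted complete
systems expanded by constant symbols `K`. -/
inductive Formula (K : Idx 𝒥 → Type u) : List (Idx 𝒥) → Type u
  | falsum {Γ} : Formula K Γ
  | equal {Γ} {s : Idx 𝒥} : Term K Γ s → Term K Γ s → Formula K Γ
  | le {Γ} {s t : Idx 𝒥} : Term K Γ s → Term K Γ t → Formula K Γ
  | C {Γ} {s t : Idx 𝒥} : Term K Γ s → Term K Γ t → Formula K Γ
  | P {Γ} {s : Idx 𝒥} : Term K Γ s → Term K Γ s → Term K Γ s → Formula K Γ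
  | imp {Γ} : Formula K Γ → Formula K Γ → Formula K Γ
  | all {Γ} (s : Idx 𝒥) : Formula K (s :: Γ) → Formula K Γ

/-- Negation. -/
def Formula.not {K : Idx 𝒥 → Type u} {Γ : List (Idx 𝒥)} (φ : Formula K Γ) : Formula K Γ :=
  φ.imp .falsum

/-- Tuples of elements of `M` of the sorts listed in a context. -/
def Env (M : Str 𝒥) : List (Idx 𝒥) → Type u
  | [] => PUnit
  | s :: Γ => M.carrier s × Env M Γ

/-- The value of a variable. -/
def Var.eval {M : Str 𝒥} : {Γ : List (Idx 𝒥)} → {s : Idx 𝒥} → Var Γ s → Env M Γ → M.carrier s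
  | _, _, .zero, v => v.1
  | _, _, .succ x, v => x.eval v.2

/-- The value of a term, for an interpretation `ι` of the constant symbols. -/
def Term.eval {K : Idx 𝒥 → Type u} {M : Str 𝒥} (ι : ∀ s, K s → M.carrier s)
    {Γ : List (Idx 𝒥)} {s : Idx 𝒥} : Term K Γ s → Env M Γ → M.carrier s
  | .var x, v => x.eval v
  | .const c, _ => ι s c

/-- Satisfaction of a formula in `M`. -/
def Formula.Realize {K : Idx 𝒥 → Type u} {M : Str 𝒥} (ι : ∀ s, K s → M.carrier s) :
    {Γ : List (Idx 𝒥)} → Formula K Γ → Env M Γ → Prop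
  | _, .falsum, _ => False
  | _, .equal x y, v => x.eval ι v = y.eval ι v
  | _, .le x y, v => M.le (x.eval ι v) (y.eval ι v)
  | _, .C x y, v => M.C (x.eval ι v) (y.eval ι v)
  | _, .P x y z, v => M.P (x.eval ι v) (y.eval ι v) (z.eval ι v)
  | _, .imp φ ψ, v => φ.Realize ι v → ψ.Realize ι v
  | _, .all s φ, v => ∀ x : M.carrier s, φ.Realize ι (x, v)

/-- Sentences without constant symbols. -/
abbrev Sentence (𝒥 : Type u) : Type u := Formula (𝒥 := 𝒥) (fun _ => PEmpty.{u + 1}) []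

/-- `M ⊨ σ`. -/
def Sentence.Holds (M : Str 𝒥) (σ : Sentence 𝒥) : Prop :=
  Formula.Realize (M := M) (fun _ c => c.elim) σ PUnit.unit

/-- The complete theory `Th(M)`. -/
def Th (M : Str 𝒥) : Set (Sentence 𝒥) := {σ | Sentence.Holds M σ}

/-- The constant symbols naming the elements of a subset `A` of `M`. -/
def Param (M : Str 𝒥) (A : Set M.Elem) (s : Idx 𝒥) : Type u :=
  {x : M.carrier s // (⟨s, x⟩ : M.Elem) ∈ A}

/-- The interpretation of these constant symbols in `M`. -/
def paramVal (M : Str 𝒥) (A : Set M.Elem) (s : Idx 𝒥) (c : Param M A s) : M.carrier s := c.1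

/-- `tp(a/A)`: the formulas in one variable with parameters from `A` that hold of `a` in `M`. -/
def tp (M : Str 𝒥) (A : Set M.Elem) {s : Idx 𝒥} (a : M.carrier s) :
    Set (Formula (Param M A) [s]) :=
  {φ | φ.Realize (paramVal M A) (a, PUnit.unit)}

/-- Complete types over `A` in variables of sorts `Γ`: complete sets of formulas with parameters
from `A` that are finitely satisfiable in `M`. -/
def IsCompleteType (M : Str 𝒥) (A : Set M.Elem) {Γ : List (Idx 𝒥)}
    (p : Set (Formula (Param M A) Γ)) : Prop :=
  (∀ φ, φ ∈ p ∨ φ.not ∈ p) ∧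
    ∀ q ⊆ p, q.Finite → ∃ v : Env M Γ, ∀ φ ∈ q, φ.Realize (paramVal M A) v

/-- A theory is `ω`-stable if over each countable subset of each of its models there are only
countably many complete types in each finite tuple of variables. -/
def OmegaStable (T : Set (Sentence 𝒥)) : Prop :=
  ∀ M : Str 𝒥, (∀ σ ∈ T, Sentence.Holds M σ) → ∀ A : Set M.Elem, A.Countable →
    ∀ Γ : List (Idx 𝒥), {p : Set (Formula (Param M A) Γ) | IsCompleteType M A p}.Countable

end SortedSystem

namespace SortedSystem
universe u
variable {𝒥 : Type u} {Jsub : ℕ+ → Tuple 𝒥 → Tuple 𝒥}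

/-! ### Coordinates for sorted complete systems -/

/-! A model of `SCS` is put in coordinates: its elements become cosets of normal subgroups of finite
index in an abstract group, the pairs (subgroup, tuple) that occur form a `SortedFilter`, and
subsystems are smaller filters (`exists_sortedFilter`). Above any one subgroup, an embedding induces
an isomorphism of finite quotients. As in Goursat's lemma this is recorded by a subgroup H of the
product of the two groups that projects onto both factors. Elements related by H (`Rel`) satisfy the
same atomic relations.

Co-SEP lets a correspondence between finite sets of elements be extended by one more element
(`extend`), so back-and-forth shows that corresponding tuples have the same type
(`typeOf_eq_of_relEnv`). The sorts of a tuple bound the index of the intersection of its subgroups,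
so only finitely many multiplication tables, and hence finitely many types, occur for given sorts
(`finite_range_typeOf`). Types are therefore isolated within S, and equality of types conversely
produces a correspondence (`exists_relEnv_of_typeOf_eq`).

Types over a subsystem A: the indices of the joins N(a) ⊔ N, with N from A, are bounded, so a least
join N(c) is attained. If a and b have the same type, some correspondence carries a to b and is the
identity modulo a subgroup of A attaining the join; it induces the isomorphism. Conversely, the
isomorphism gives a correspondence carrying a to b that is the identity modulo N(c). For every N₁
from A, N(c) lies below N(a) ⊔ N₁ and N(b) ⊔ N₁, so the correspondence can be glued with the
identity modulo N₁ (`BiSurj.exists_amalgam`). The result still carries a to b and fixes any finite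
set of parameters above N₁.

Stability: a model M of Th(S) comes without coordinates, but each finite tuple of M has a copy in S
of the same type. A complete type is a limit of tuples along an ultrafilter. The index of the join
of such a tuple with a finite tuple of parameters is bounded and grows with the parameters, so its
limit is constant beyond some finite list l. The same gluing shows that the complete type is
determined by l and by a limit type over a tuple enumerating enough cosets for l. There are
countably many l, and finitely many limit types for each. -/

/-- A filter of normal subgroups of finite index together with a sorting data on it: `Mem N J` says
that `N` belongs to the filter and `J` to the set of tuples attached to `N`. -/
structure SortedFilter (Jsub : ℕ+ → Tuple 𝒥 → Tuple 𝒥) (G : Type u) [Group G] where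
  /-- the tuples attached to the subgroups -/
  Mem : Subgroup G → Tuple 𝒥 → Prop
  inhabited : Nonempty (Tuple 𝒥)
  normal : ∀ {N J}, Mem N J → N.Normal
  index_ne : ∀ {N J}, Mem N J → N.index ≠ 0
  top : ∀ J, Mem ⊤ J
  rad : ∀ {N J J'}, Mem N J → J' ∈ J.rad → Mem N J'
  up : ∀ {N₁ N₂ J} (k : ℕ+), Mem N₁ J → N₁ ≤ N₂ → N₂.Normal → N₁.index ≤ k → Mem N₂ (Jsub k J)
  inf : ∀ {N₁ N₂ J₁ J₂}, Mem N₁ J₁ → Mem N₂ J₂ → Mem (N₁ ⊓ N₂) (J₁.append J₂)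

/-- Coordinates of a structure in a group `G`: each element is viewed as a coset `cos x` of a
normal subgroup `N x`. -/
structure Coord {G : Type u} [Group G] (F : SortedFilter Jsub G) (S : Str 𝒥) where
  /-- the normal subgroup -/
  N : ∀ {s}, S.carrier s → Subgroup G
  /-- the coset -/
  cos : ∀ {s}, S.carrier s → Set G
  nonempty : ∀ {s} (x : S.carrier s), (cos x).Nonempty
  mem_cos : ∀ {s} {x : S.carrier s} {g : G} (h : G), g ∈ cos x → (h ∈ cos x ↔ g⁻¹ * h ∈ N x)
  mem : ∀ {s} (x : S.carrier s), F.Mem (N x) s.2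
  index_le : ∀ {s} (x : S.carrier s), (N x).index ≤ s.1
  le_iff : ∀ {s t} (x : S.carrier s) (y : S.carrier t), S.le x y ↔ N x ≤ N y
  C_iff : ∀ {s t} (x : S.carrier s) (y : S.carrier t), S.C x y ↔ cos x ⊆ cos y
  P_iff : ∀ {s} (x y z : S.carrier s),
    S.P x y z ↔ N x = N y ∧ N y = N z ∧ ∃ g ∈ cos x, ∃ h ∈ cos y, g * h ∈ cos z
  ext : ∀ {s} {x y : S.carrier s} {g : G}, N x = N y → g ∈ cos x → g ∈ cos y → x = y
  exists_mem : ∀ {N' : Subgroup G} {s : Idx 𝒥}, F.Mem N' s.2 → N'.index ≤ s.1 → ∀ g : G,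
    ∃ x : S.carrier s, N x = N' ∧ g ∈ cos x

theorem Tuple.self_mem_rad (J : Tuple 𝒥) : J ∈ J.rad := fun _ h => h

/-- The sorted filter of all open normal subgroups of a sorted profinite group. -/
def SortingData.toSortedFilter {G : ProfiniteGrp.{u}} (D : SortingData Jsub G) :
    SortedFilter Jsub G where
  Mem N J := ∃ N' : OpenNormalSubgroup G, (N' : Subgroup G) = N ∧ J ∈ D.F N'
  inhabited := by
    let T : OpenNormalSubgroup G := { (⊤ : OpenSubgroup G) with
      isNormal' := by
        change (⊤ : Subgroup G).Normal
        infer_instance }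
    obtain ⟨J, -⟩ := D.nonempty T
    exact ⟨J⟩
  normal := by
    rintro N J ⟨N', rfl, -⟩
    infer_instance
  index_ne := by
    rintro N J ⟨N', rfl, -⟩
    exact Subgroup.index_ne_zero_of_finite
  top J := by
    let T : OpenNormalSubgroup G := { (⊤ : OpenSubgroup G) with
      isNormal' := by
        change (⊤ : Subgroup G).Normal
        infer_instance }
    exact ⟨T, rfl, by rw [D.whole T rfl]; trivial⟩
  rad := by
    rintro N J J' ⟨N', rfl, h⟩ h'
    exact ⟨N', rfl, (D.rad_iff N' J).1 h h'⟩
  up := by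
    rintro N₁ N₂ J k ⟨N', rfl, h⟩ hle hn hk
    let M : OpenNormalSubgroup G :=
      { toSubgroup := N₂
        isOpen' := Subgroup.isOpen_mono hle N'.isOpen'
        isNormal' := hn }
    exact ⟨M, rfl, D.mono N' M k J hle hk h⟩
  inf := by
    rintro _ _ J₁ J₂ ⟨N₁, rfl, h₁⟩ ⟨N₂, rfl, h₂⟩
    exact ⟨N₁ ⊓ N₂, rfl, D.inter N₁ N₂ J₁ J₂ h₁ h₂⟩

/-- The coordinates of `S(G, F)`. -/
def completeSystemCoord {G : ProfiniteGrp.{u}} (D : SortingData Jsub G) :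
    Coord D.toSortedFilter (completeSystem G D) where
  N x := x.1.1
  cos x := {g : G | (QuotientGroup.mk g : G ⧸ (x.1.1 : Subgroup G)) = x.2}
  nonempty x := QuotientGroup.mk_surjective x.2
  mem_cos := by
    intro s x g h hg
    simp only [Set.mem_ofPred_eq] at hg ⊢
    rw [← hg, eq_comm, QuotientGroup.eq]
  mem x := ⟨x.1.1, rfl, x.1.2.2⟩
  index_le x := x.1.2.1
  le_iff x y := Iff.rfl
  C_iff x y := Iff.rfl
  P_iff := by
    rintro s ⟨N₁, x⟩ ⟨N₂, y⟩ ⟨N₃, z⟩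
    constructor
    · rintro ⟨N, g, h, h₁, h₂, h₃⟩
      cases h₁
      cases h₂
      cases h₃
      exact ⟨rfl, rfl, g, rfl, h, rfl, rfl⟩
    · rintro ⟨h₁, h₂, g, hg, h, hh, hgh⟩
      have e₁ : N₁ = N₂ := Subtype.ext (OpenNormalSubgroup.toSubgroup_injective h₁)
      have e₂ : N₂ = N₃ := Subtype.ext (OpenNormalSubgroup.toSubgroup_injective h₂)
      subst e₁ e₂
      simp only [Set.mem_ofPred_eq] at hg hh hgh
      exact ⟨N₁, g, h, by rw [hg], by rw [hh], by rw [hgh]⟩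
  ext := by
    rintro s ⟨N₁, x⟩ ⟨N₂, y⟩ g h₁ hx hy
    have e₁ : N₁ = N₂ := Subtype.ext (OpenNormalSubgroup.toSubgroup_injective h₁)
    subst e₁
    simp only [Set.mem_ofPred_eq] at hx hy
    rw [← hx, ← hy]
  exists_mem := by
    rintro _ s ⟨N, rfl, hN⟩ hk g
    exact ⟨⟨⟨N, hk, hN⟩, QuotientGroup.mk g⟩, rfl, rfl⟩

/-- Transport of coordinates along an isomorphism. -/
noncomputable def Coord.ofIso {G : Type u} [Group G] {F : SortedFilter Jsub G} {T S : Str 𝒥}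
    (C : Coord F T) (i : Iso T S) : Coord F S :=
  let e : ∀ s, T.carrier s ≃ S.carrier s := fun s =>
    Equiv.ofBijective (i.toFun s) ⟨i.injective s, i.surjective s⟩
  have he : ∀ s (y : S.carrier s), i.toFun s ((e s).symm y) = y :=
    fun s y => (e s).apply_symm_apply y
  { N := fun {s} y => C.N ((e s).symm y)
    cos := fun {s} y => C.cos ((e s).symm y)
    nonempty := fun y => C.nonempty _
    mem_cos := fun h => C.mem_cos h
    mem := fun y => C.mem _
    index_le := fun y => C.index_le _
    le_iff := fun x y => by rw [← C.le_iff, ← i.le_iff, he, he]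
    C_iff := fun x y => by rw [← C.C_iff, ← i.C_iff, he, he]
    P_iff := fun x y z => by rw [← C.P_iff, ← i.P_iff, he, he, he]
    ext := fun h h₁ h₂ => (e _).symm.injective (C.ext h h₁ h₂)
    exists_mem := fun h hk g => by
      obtain ⟨x, hx, hg⟩ := C.exists_mem h hk g
      exact ⟨e _ x, by simpa using hx, by simpa using hg⟩ }

/-- The topology can be forgotten from here on: the abstract group and its filter of subgroups
already determine the structure. -/
theorem IsSCS.exists_coord {S : Str 𝒥} (h : IsSCS Jsub S) :
    ∃ (G : Type u) (_ : Group G) (F : SortedFilter Jsub G), Nonempty (Coord F S) := by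
  obtain ⟨G, D, ⟨i⟩⟩ := h
  exact ⟨G, inferInstance, D.toSortedFilter, ⟨(completeSystemCoord D).ofIso i⟩⟩

namespace Coord

section basic
variable {G : Type u} [Group G] {F : SortedFilter Jsub G} {S : Str 𝒥} (C : Coord F S)
  {s t : Idx 𝒥}

theorem normal (x : S.carrier s) : (C.N x).Normal := F.normal (C.mem x)

theorem index_ne (x : S.carrier s) : (C.N x).index ≠ 0 := F.index_ne (C.mem x)

/-- The restriction of coordinates to a substructure given by a smaller sorted filter. -/
def restrict (F' : SortedFilter Jsub G) (hF : ∀ N J, F'.Mem N J → F.Mem N J) (A : Set S.Elem)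
    (hA : ∀ s (x : S.carrier s), (⟨s, x⟩ : S.Elem) ∈ A ↔ F'.Mem (C.N x) s.2) :
    Coord F' (S.induce A) where
  N x := C.N x.1
  cos x := C.cos x.1
  nonempty x := C.nonempty x.1
  mem_cos h := C.mem_cos h
  mem x := (hA _ _).1 x.2
  index_le x := C.index_le x.1
  le_iff x y := C.le_iff x.1 y.1
  C_iff x y := C.C_iff x.1 y.1
  P_iff x y z := C.P_iff x.1 y.1 z.1
  ext h h₁ h₂ := Subtype.ext (C.ext h h₁ h₂)
  exists_mem h hk g := by
    obtain ⟨x, rfl, hx⟩ := C.exists_mem (hF _ _ h) hk g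
    exact ⟨⟨x, (hA _ _).2 h⟩, rfl, hx⟩

theorem cos_subset_iff {x : S.carrier s} {y : S.carrier t} {g : G} (hx : g ∈ C.cos x)
    (hy : g ∈ C.cos y) : C.cos x ⊆ C.cos y ↔ C.N x ≤ C.N y := by
  constructor
  · intro h n hn
    have : g * n ∈ C.cos y := h ((C.mem_cos _ hx).2 (by simpa using hn))
    simpa using (C.mem_cos _ hy).1 this
  · intro h n hn
    exact (C.mem_cos _ hy).2 (h ((C.mem_cos _ hx).1 hn))

/-- Below a given subgroup, membership of a point in a coset is a fact about the relation `C`. This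
is how group elements are read off from the structure. -/
theorem C_iff_of_le {x : S.carrier s} {y : S.carrier t} {g : G} (hx : g ∈ C.cos x)
    (h : C.N x ≤ C.N y) : S.C x y ↔ g ∈ C.cos y := by
  rw [C.C_iff]
  exact ⟨fun h' => h' hx, fun hy => (C.cos_subset_iff hx hy).2 h⟩

/-- Another coset of the same subgroup, in the same sort. -/
theorem exists_coset (x : S.carrier s) (g : G) :
    ∃ y : S.carrier s, C.N y = C.N x ∧ g ∈ C.cos y :=
  C.exists_mem (C.mem x) (C.index_le x) g

end basic

end Coord

/-! ### Correspondences -/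

section BiSurj
variable {G G' : Type u} [Group G] [Group G']

/-- A subgroup of a product that projects onto both factors. -/
def BiSurj (H : Subgroup (G × G')) : Prop :=
  (∀ g, ∃ h, (g, h) ∈ H) ∧ ∀ h, ∃ g, (g, h) ∈ H

/-- The image of a subgroup under a correspondence. -/
def corrImage (H : Subgroup (G × G')) (N : Subgroup G) : Subgroup G' :=
  (N.comap ((MonoidHom.fst G G').comp H.subtype)).map ((MonoidHom.snd G G').comp H.subtype)

theorem mem_corrImage {H : Subgroup (G × G')} {N : Subgroup G} {h : G'} :
    h ∈ corrImage H N ↔ ∃ g ∈ N, (g, h) ∈ H := by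
  constructor
  · rintro ⟨⟨⟨g, h'⟩, hp⟩, hg, rfl⟩
    exact ⟨g, hg, hp⟩
  · rintro ⟨g, hg, hp⟩
    exact ⟨⟨(g, h), hp⟩, hg, rfl⟩

theorem BiSurj.corrImage_normal {H : Subgroup (G × G')} (hH : BiSurj H) {N : Subgroup G}
    (hN : N.Normal) : (corrImage H N).Normal := by
  constructor
  intro n hn h
  obtain ⟨g, hg, hgn⟩ := mem_corrImage.1 hn
  obtain ⟨k, hk⟩ := hH.2 h
  exact mem_corrImage.2 ⟨k * g * k⁻¹, hN.conj_mem g hg k, H.mul_mem (H.mul_mem hk hgn) (H.inv_mem hk)⟩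

/-- The hypothesis says that N contains the left kernel of H; then H induces an isomorphism of the
quotients by N and by its image. -/
theorem BiSurj.corrImage_index {H : Subgroup (G × G')} (hH : BiSurj H) {N : Subgroup G}
    (hN : ∀ g, (g, (1 : G')) ∈ H → g ∈ N) : (corrImage H N).index = N.index := by
  rw [corrImage, Subgroup.index_map_eq, Subgroup.index_comap_of_surjective]
  · intro g
    obtain ⟨h, hp⟩ := hH.1 g
    exact ⟨⟨(g, h), hp⟩, rfl⟩
  · intro h
    obtain ⟨g, hp⟩ := hH.2 h
    exact ⟨⟨(g, h), hp⟩, rfl⟩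
  · rintro ⟨⟨g, h⟩, hp⟩ hh
    have : h = 1 := hh
    subst this
    exact hN g hp

theorem corrImage_mono {H : Subgroup (G × G')} {N M : Subgroup G} (h : N ≤ M) :
    corrImage H N ≤ corrImage H M := by
  intro x hx
  obtain ⟨g, hg, hp⟩ := mem_corrImage.1 hx
  exact mem_corrImage.2 ⟨g, h hg, hp⟩

/-- Two preimages of one point differ by an element of the left kernel, which N absorbs; so a
preimage in M also lies in N. -/
theorem corrImage_inf {H : Subgroup (G × G')} {N M : Subgroup G}
    (hN : ∀ g, (g, (1 : G')) ∈ H → g ∈ N) :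
    corrImage H (N ⊓ M) = corrImage H N ⊓ corrImage H M := by
  apply le_antisymm
  · exact le_inf (corrImage_mono inf_le_left) (corrImage_mono inf_le_right)
  · rintro x ⟨hx, hy⟩
    obtain ⟨g, hg, hp⟩ := mem_corrImage.1 hx
    obtain ⟨g', hg', hp'⟩ := mem_corrImage.1 hy
    refine mem_corrImage.2 ⟨g', ⟨?_, hg'⟩, hp'⟩
    have : g' * g⁻¹ ∈ N := hN _ (by simpa using H.mul_mem hp' (H.inv_mem hp))
    simpa using N.mul_mem this hg

theorem BiSurj.corrImage_top {H : Subgroup (G × G')} (hH : BiSurj H) : corrImage H ⊤ = ⊤ := by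
  rw [eq_top_iff]
  intro h _
  obtain ⟨g, hg⟩ := hH.2 h
  exact mem_corrImage.2 ⟨g, trivial, hg⟩

theorem corrImage_eq {H : Subgroup (G × G')} (hH : BiSurj H) {N : Subgroup G} {N' : Subgroup G'}
    (h : ∀ p ∈ H, p.1 ∈ N ↔ p.2 ∈ N') : corrImage H N = N' := by
  ext x
  rw [mem_corrImage]
  constructor
  · rintro ⟨g, hg, hp⟩
    exact (h _ hp).1 hg
  · intro hx
    obtain ⟨g, hg⟩ := hH.2 x
    exact ⟨g, (h _ hg).2 hx, hg⟩

/-- The inverse correspondence. -/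
def corrInv (H : Subgroup (G × G')) : Subgroup (G' × G) :=
  H.comap ((MonoidHom.snd G' G).prod (MonoidHom.fst G' G))

theorem BiSurj.inv {H : Subgroup (G × G')} (hH : BiSurj H) : BiSurj (corrInv H) :=
  ⟨hH.2, hH.1⟩

end BiSurj

/-! ### Elements related by a correspondence -/

namespace Coord

section Rel
variable {G G' : Type u} [Group G] [Group G'] {F : SortedFilter Jsub G} {F' : SortedFilter Jsub G'}
  {T S : Str 𝒥} (C : Coord F T) (C' : Coord F' S) {s t : Idx 𝒥}

/-- Two elements correspond to each other under a correspondence between groups. -/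
def Rel (H : Subgroup (G × G')) (x : T.carrier s) (y : S.carrier t) : Prop :=
  ∀ p ∈ H, p.1 ∈ C.cos x ↔ p.2 ∈ C'.cos y

variable {C C'} {H : Subgroup (G × G')}

theorem Rel.symm {x : T.carrier s} {y : S.carrier t} (h : C.Rel C' H x y) :
    C'.Rel C (corrInv H) y x := fun _ hp => (h _ hp).symm

/-- The subgroup is the stabilizer of the coset under right translation, so a pair of H over a point
of the coset is multiplied by p. -/
theorem Rel.mem_N (hH : BiSurj H) {x : T.carrier s} {y : S.carrier t} (h : C.Rel C' H x y)
    {p : G × G'} (hp : p ∈ H) : p.1 ∈ C.N x ↔ p.2 ∈ C'.N y := by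
  obtain ⟨g, hg⟩ := C.nonempty x
  obtain ⟨k, hk⟩ := hH.1 g
  have h₁ := h _ (H.mul_mem hk hp)
  have h₂ := (h _ hk).1 hg
  simpa [C.mem_cos _ hg, C'.mem_cos _ h₂] using h₁

theorem Rel.corrImage_N (hH : BiSurj H) {x : T.carrier s} {y : S.carrier t}
    (h : C.Rel C' H x y) : corrImage H (C.N x) = C'.N y :=
  corrImage_eq hH fun _ hp => h.mem_N hH hp

theorem Rel.of_one (hH : BiSurj H) {x : T.carrier s} {y : S.carrier t}
    (h : C.Rel C' H x y) {g : G} (hg : (g, (1 : G')) ∈ H) : g ∈ C.N x :=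
  (h.mem_N hH hg).2 (C'.N y).one_mem

theorem Rel.le_iff (hH : BiSurj H) {s' t' : Idx 𝒥} {x : T.carrier s} {y : S.carrier t}
    (h : C.Rel C' H x y) {x' : T.carrier s'} {y' : S.carrier t'} (h' : C.Rel C' H x' y') :
    C'.N y ≤ C'.N y' ↔ C.N x ≤ C.N x' := by
  constructor
  · intro hle g hg
    obtain ⟨k, hk⟩ := hH.1 g
    exact (h'.mem_N hH hk).2 (hle ((h.mem_N hH hk).1 hg))
  · intro hle g hg
    obtain ⟨k, hk⟩ := hH.2 g
    exact (h'.mem_N hH hk).1 (hle ((h.mem_N hH hk).2 hg))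

theorem Rel.subset_iff (hH : BiSurj H) {s' t' : Idx 𝒥} {x : T.carrier s} {y : S.carrier t}
    (h : C.Rel C' H x y) {x' : T.carrier s'} {y' : S.carrier t'} (h' : C.Rel C' H x' y') :
    C'.cos y ⊆ C'.cos y' ↔ C.cos x ⊆ C.cos x' := by
  constructor
  · intro hle g hg
    obtain ⟨k, hk⟩ := hH.1 g
    exact (h' _ hk).2 (hle ((h _ hk).1 hg))
  · intro hle g hg
    obtain ⟨k, hk⟩ := hH.2 g
    exact (h' _ hk).1 (hle ((h _ hk).2 hg))

theorem Rel.P_iff (hH : BiSurj H) {x₁ x₂ x₃ : T.carrier s} {y₁ y₂ y₃ : S.carrier t}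
    (h₁ : C.Rel C' H x₁ y₁) (h₂ : C.Rel C' H x₂ y₂) (h₃ : C.Rel C' H x₃ y₃) :
    S.P y₁ y₂ y₃ ↔ T.P x₁ x₂ x₃ := by
  rw [C.P_iff, C'.P_iff]
  simp only [le_antisymm_iff, h₁.le_iff hH h₂, h₂.le_iff hH h₁, h₂.le_iff hH h₃, h₃.le_iff hH h₂]
  refine and_congr_right fun _ => and_congr_right fun _ => ?_
  constructor
  · rintro ⟨g, hg, k, hk, hgk⟩
    obtain ⟨g', hg'⟩ := hH.2 g
    obtain ⟨k', hk'⟩ := hH.2 k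
    exact ⟨g', (h₁ _ hg').2 hg, k', (h₂ _ hk').2 hk, (h₃ _ (H.mul_mem hg' hk')).2 hgk⟩
  · rintro ⟨g, hg, k, hk, hgk⟩
    obtain ⟨g', hg'⟩ := hH.1 g
    obtain ⟨k', hk'⟩ := hH.1 k
    exact ⟨g', (h₁ _ hg').1 hg, k', (h₂ _ hk').1 hk, (h₃ _ (H.mul_mem hg' hk')).1 hgk⟩

theorem Rel.eq_iff (hH : BiSurj H) {x x' : T.carrier s} {y y' : S.carrier t}
    (h : C.Rel C' H x y) (h' : C.Rel C' H x' y') : y = y' ↔ x = x' := by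
  constructor
  · rintro rfl
    obtain ⟨g, hg⟩ := C.nonempty x
    obtain ⟨k, hk⟩ := hH.1 g
    refine C.ext (le_antisymm ?_ ?_) hg ((h' _ hk).2 ((h _ hk).1 hg))
    · exact (h.le_iff hH h').1 le_rfl
    · exact (h'.le_iff hH h).1 le_rfl
  · rintro rfl
    obtain ⟨g, hg⟩ := C'.nonempty y
    obtain ⟨k, hk⟩ := hH.2 g
    refine C'.ext (le_antisymm ?_ ?_) hg ((h' _ hk).1 ((h _ hk).2 hg))
    · exact (h.le_iff hH h').2 le_rfl
    · exact (h'.le_iff hH h).2 le_rfl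

variable (C C') in
theorem exists_rel (hH : BiSurj H) (x : T.carrier s) (hx : ∀ g, (g, (1 : G')) ∈ H → g ∈ C.N x)
    (hF : F'.Mem (corrImage H (C.N x)) s.2) : ∃ y : S.carrier s, C.Rel C' H x y := by
  obtain ⟨g, hg⟩ := C.nonempty x
  obtain ⟨k, hk⟩ := hH.1 g
  obtain ⟨y, hy, hky⟩ := C'.exists_mem hF (by
    rw [hH.corrImage_index hx]
    exact C.index_le x) k
  refine ⟨y, fun p hp => ?_⟩
  rw [C.mem_cos _ hg, C'.mem_cos _ hky, hy, mem_corrImage]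
  have h₁ : (g⁻¹ * p.1, k⁻¹ * p.2) ∈ H := H.mul_mem (H.inv_mem hk) hp
  constructor
  · exact fun h => ⟨_, h, h₁⟩
  · rintro ⟨g', hg', h₂⟩
    have h₃ := hx (g⁻¹ * p.1 * g'⁻¹) (by simpa using H.mul_mem h₁ (H.inv_mem h₂))
    simpa using (C.N x).mul_mem h₃ hg'

/-- A correspondence defined on all of a structure is an embedding. -/
def embedding (hH : BiSurj H) (f : ∀ s, T.carrier s → S.carrier s)
    (hf : ∀ s x, C.Rel C' H x (f s x)) : Embedding T S where
  toFun := f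
  injective s x y h := ((hf s x).eq_iff hH (hf s y)).1 h
  le_iff x y := by
    rw [C.le_iff, C'.le_iff]
    exact (hf _ x).le_iff hH (hf _ y)
  C_iff x y := by
    rw [C.C_iff, C'.C_iff]
    exact (hf _ x).subset_iff hH (hf _ y)
  P_iff x y z := (hf _ x).P_iff hH (hf _ y) (hf _ z)

/-- A bijective correspondence is an isomorphism. -/
def iso (hH : BiSurj H) (f : ∀ s, T.carrier s → S.carrier s)
    (hf : ∀ s x, C.Rel C' H x (f s x)) (hs : ∀ s (y : S.carrier s), ∃ x : T.carrier s,
      C.Rel C' H x y) : Iso T S where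
  toEmbedding := embedding hH f hf
  surjective s y := by
    obtain ⟨x, hx⟩ := hs s y
    exact ⟨x, ((hf s x).eq_iff hH hx).2 rfl⟩

end Rel

end Coord

/-- The inclusion of a substructure. -/
def Str.inclusion (S : Str 𝒥) (A : Set S.Elem) : Embedding (S.induce A) S where
  toFun _ x := x.1
  injective _ := Subtype.val_injective
  le_iff _ _ := Iff.rfl
  C_iff _ _ := Iff.rfl
  P_iff _ _ _ := Iff.rfl

/-! ### Embeddings are correspondences -/

/-- A multiplicative relation whose fibres are cosets is a subgroup of the product. -/
theorem exists_subgroup_of_rel {G G' : Type u} [Group G] [Group G'] {R : G → G' → Prop}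
    {N : Subgroup G'} (hex : ∀ g, ∃ h, R g h)
    (hmul : ∀ {g h g' h'}, R g h → R g' h' → R (g * g') (h * h'))
    (hR : ∀ {g h h'}, R g h → (R g h' ↔ h⁻¹ * h' ∈ N)) :
    ∃ H : Subgroup (G × G'), ∀ p, p ∈ H ↔ R p.1 p.2 := by
  -- From R 1 k follows R 1 (k * k), which forces k into N. This supplies the unit, and then the
  -- inverses, from multiplicativity alone.
  have hone : R 1 1 := by
    obtain ⟨k, hk⟩ := hex 1
    have h₁ : k⁻¹ * (k * k) ∈ N := (hR hk).1 (by simpa using hmul hk hk)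
    exact (hR hk).2 (by simpa using h₁)
  refine ⟨{ carrier := {p | R p.1 p.2}, mul_mem' := fun h₁ h₂ => hmul h₁ h₂, one_mem' := hone,
            inv_mem' := ?_ }, fun _ => Iff.rfl⟩
  rintro ⟨g, h⟩ hp
  obtain ⟨k, hk⟩ := hex g⁻¹
  have h₁ : R 1 (h * k) := by simpa using hmul hp hk
  refine (hR hk).2 ?_
  have h₂ : h * k ∈ N := by simpa using (hR hone).1 h₁
  simpa using N.inv_mem h₂

namespace Coord

/-- `P` only provides one pair of representatives; normality passes to all others. -/
theorem mul_mem_of_P {G : Type u} [Group G] {F : SortedFilter Jsub G} {S : Str 𝒥} (C : Coord F S)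
    {s : Idx 𝒥} {x y z : S.carrier s} (hP : S.P x y z) {g h : G} (hg : g ∈ C.cos x)
    (hh : h ∈ C.cos y) : g * h ∈ C.cos z := by
  obtain ⟨h₁, h₂, g', hg', h', hh', hm⟩ := (C.P_iff _ _ _).1 hP
  have hn := C.normal z
  rw [C.mem_cos _ hm]
  have h₃ := (C.mem_cos _ hg').1 hg
  have h₄ := (C.mem_cos _ hh').1 hh
  rw [h₁, h₂] at h₃
  rw [h₂] at h₄
  simpa [mul_assoc] using (C.N z).mul_mem (hn.conj_mem _ h₃ h'⁻¹) h₄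

section Embedding
variable {G G' : Type u} [Group G] [Group G'] {F : SortedFilter Jsub G} {F' : SortedFilter Jsub G'}
  {T S : Str 𝒥} (C : Coord F T) (C' : Coord F' S) (e : Embedding T S) {s t : Idx 𝒥}

theorem N_toFun_le_iff (x : T.carrier s) (y : T.carrier t) :
    C'.N (e.toFun s x) ≤ C'.N (e.toFun t y) ↔ C.N x ≤ C.N y := by
  rw [← C'.le_iff, e.le_iff, C.le_iff]

theorem N_toFun_eq_iff (x : T.carrier s) (y : T.carrier t) :
    C'.N (e.toFun s x) = C'.N (e.toFun t y) ↔ C.N x = C.N y := by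
  simp only [le_antisymm_iff, C.N_toFun_le_iff C' e]

theorem index_toFun_le (x : T.carrier s) : (C'.N (e.toFun s x)).index ≤ (C.N x).index := by
  -- The tightest sort: a coset of N x placed in the sort whose bound is exactly the index must be
  -- sent to a coset of index at most that bound.
  let m : ℕ+ := ⟨(C.N x).index, Nat.pos_of_ne_zero (C.index_ne x)⟩
  obtain ⟨y, hy, -⟩ := C.exists_mem (s := (m, s.2)) (C.mem x) le_rfl 1
  rw [← (C.N_toFun_eq_iff C' e y x).2 hy]
  exact C'.index_le (e.toFun _ y)

/-- An embedding is injective on the elements of sort s that name the cosets of N x. Together with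
`index_toFun_le` this shows that the index is preserved and that all cosets of the image subgroup
are hit. -/
theorem exists_injective_quotient (x : T.carrier s) :
    ∃ f : G ⧸ C.N x → G' ⧸ C'.N (e.toFun s x), Function.Injective f ∧
      ∀ q, ∃ y : T.carrier s, C.N y = C.N x ∧ ∃ r ∈ C'.cos (e.toFun s y), f q = r := by
  choose c hc hmem using fun g => C.exists_coset x g
  have hN : ∀ g, C'.N (e.toFun s (c g)) = C'.N (e.toFun s x) :=
    fun g => (C.N_toFun_eq_iff C' e _ _).2 (hc g)
  choose r hr using fun g => C'.nonempty (e.toFun s (c g))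
  refine ⟨fun q => QuotientGroup.mk (r q.out), ?_, fun q => ⟨c q.out, hc _, _, hr _, rfl⟩⟩
  intro q q' h
  have h₁ : (r q.out)⁻¹ * r q'.out ∈ C'.N (e.toFun s x) := QuotientGroup.eq.1 h
  have h₂ : r q'.out ∈ C'.cos (e.toFun s (c q.out)) := by
    rw [C'.mem_cos _ (hr _), hN]
    exact h₁
  have h₃ := e.injective s (C'.ext (by rw [hN, hN]) h₂ (hr q'.out))
  have h₄ := hmem q'.out
  rw [← h₃, C.mem_cos _ (hmem q.out), hc, ← QuotientGroup.eq] at h₄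
  rw [← q.out_eq', ← q'.out_eq']
  exact h₄

theorem index_toFun (x : T.carrier s) : (C'.N (e.toFun s x)).index = (C.N x).index := by
  obtain ⟨f, hf, -⟩ := C.exists_injective_quotient C' e x
  have : (C'.N (e.toFun s x)).FiniteIndex := ⟨C'.index_ne _⟩
  exact le_antisymm (C.index_toFun_le C' e x) (Nat.card_le_card_of_injective f hf)

/-- An embedding maps the cosets of a subgroup onto all cosets of the image subgroup. -/
theorem exists_toFun_mem (x : T.carrier s) (g : G') :
    ∃ y : T.carrier s, C.N y = C.N x ∧ g ∈ C'.cos (e.toFun s y) := by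
  obtain ⟨f, hf, hfy⟩ := C.exists_injective_quotient C' e x
  have : (C'.N (e.toFun s x)).FiniteIndex := ⟨C'.index_ne _⟩
  have hb : Function.Bijective f :=
    (Nat.bijective_iff_injective_and_card f).2 ⟨hf, (C.index_toFun C' e x).symm⟩
  obtain ⟨q, hq⟩ := hb.2 (QuotientGroup.mk g)
  obtain ⟨y, hy, r, hr, hqr⟩ := hfy q
  refine ⟨y, hy, (C'.mem_cos _ hr).2 ?_⟩
  rw [(C.N_toFun_eq_iff C' e y x).2 hy]
  exact QuotientGroup.eq.1 (hqr.symm.trans hq)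

/-- The correspondence given by an embedding on the cosets of a subgroup. -/
theorem exists_corr (x : T.carrier s) : ∃ H : Subgroup (G × G'), BiSurj H ∧
    ∀ t (y : T.carrier t), C.N x ≤ C.N y → C.Rel C' H y (e.toFun t y) := by
  -- Points are paired when they lie in a coset of N x and in its image. Every element above x is a
  -- union of such cosets, detected by `C`, so the single relation R serves for all of them.
  let R : G × G' → Prop := fun p =>
    ∃ y : T.carrier s, C.N y = C.N x ∧ p.1 ∈ C.cos y ∧ p.2 ∈ C'.cos (e.toFun s y)
  have key : ∀ p, R p → ∀ t (y : T.carrier t), C.N x ≤ C.N y →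
      (p.1 ∈ C.cos y ↔ p.2 ∈ C'.cos (e.toFun t y)) := by
    rintro p ⟨z, hz, hp₁, hp₂⟩ t y hle
    rw [← hz] at hle
    rw [← C.C_iff_of_le hp₁ hle, ← C'.C_iff_of_le hp₂ ((C.N_toFun_le_iff C' e _ _).2 hle), e.C_iff]
  have hmul : ∀ p q, R p → R q → R (p * q) := by
    rintro p q ⟨y, hy, hp₁, hp₂⟩ ⟨z, hz, hq₁, hq₂⟩
    obtain ⟨w, hw, hm⟩ := C.exists_coset x (p.1 * q.1)
    refine ⟨w, hw, hm, ?_⟩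
    exact C'.mul_mem_of_P ((e.P_iff _ _ _).2 ((C.P_iff _ _ _).2
      ⟨hy.trans hz.symm, hz.trans hw.symm, _, hp₁, _, hq₁, hm⟩)) hp₂ hq₂
  have hex₁ : ∀ g, ∃ h, R (g, h) := by
    intro g
    obtain ⟨y, hy, hg⟩ := C.exists_coset x g
    obtain ⟨h, hh⟩ := C'.nonempty (e.toFun s y)
    exact ⟨h, y, hy, hg, hh⟩
  have hex₂ : ∀ h, ∃ g, R (g, h) := by
    intro h
    obtain ⟨y, hy, hg⟩ := C.exists_toFun_mem C' e x h
    obtain ⟨g, hh⟩ := C.nonempty y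
    exact ⟨g, y, hy, hh, hg⟩
  have hR : ∀ g h h', R (g, h) → (R (g, h') ↔ h⁻¹ * h' ∈ C'.N (e.toFun s x)) := by
    rintro g h h' ⟨y, hy, h₁, h₂⟩
    rw [← (C.N_toFun_eq_iff C' e _ _).2 hy, ← C'.mem_cos _ h₂]
    constructor
    · rintro ⟨z, hz, h₃, h₄⟩
      have : z = y := C.ext (hz.trans hy.symm) h₃ h₁
      rwa [← this]
    · exact fun h₃ => ⟨y, hy, h₁, h₃⟩
  obtain ⟨H, hHR⟩ := exists_subgroup_of_rel (R := fun g h => R (g, h)) hex₁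
    (fun h₁ h₂ => hmul _ _ h₁ h₂) fun h₁ => hR _ _ _ h₁
  refine ⟨H, ⟨fun g => ?_, fun h => ?_⟩, fun t y hle p hp => key p ((hHR p).1 hp) t y hle⟩
  · obtain ⟨h, hp⟩ := hex₁ g
    exact ⟨h, (hHR _).2 hp⟩
  · obtain ⟨g, hp⟩ := hex₂ h
    exact ⟨g, (hHR _).2 hp⟩

end Embedding

/-! ### Subsystems -/

section Subsystem
variable {G : Type u} [Group G] {F : SortedFilter Jsub G} {S : Str 𝒥} (C : Coord F S)

/-- The subsystem has coordinates in a group of its own. The inclusion preserves indices and is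
locally a correspondence, which transports the closure properties of that filter into G. Membership
in A thus depends on the subgroup and the tuple alone, not on the coset or the bound of the sort. -/
theorem exists_sortedFilter {A : Set S.Elem} (hA : IsSubsystem Jsub S A) :
    ∃ F₁ : SortedFilter Jsub G, (∀ N J, F₁.Mem N J → F.Mem N J) ∧
      ∀ s (x : S.carrier s), (⟨s, x⟩ : S.Elem) ∈ A ↔ F₁.Mem (C.N x) s.2 := by
  obtain ⟨G', _, F', ⟨C'⟩⟩ := IsSCS.exists_coord hA
  let e := S.inclusion A
  let M : Subgroup G → Tuple 𝒥 → Prop := fun N J =>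
    ∃ k : ℕ+, ∃ x : (S.induce A).carrier (k, J), C.N (e.toFun _ x) = N
  have hM : ∀ N J, M N J → F.Mem N J := by
    rintro N J ⟨k, x, rfl⟩
    exact C.mem (e.toFun _ x)
  let F₁ : SortedFilter Jsub G :=
    { Mem := M
      inhabited := F.inhabited
      normal := fun h => F.normal (hM _ _ h)
      index_ne := fun h => F.index_ne (hM _ _ h)
      top := by
        intro J
        obtain ⟨x, hx, -⟩ := C'.exists_mem (s := (1, J)) (F'.top J) (by simp) 1
        refine ⟨1, x, ?_⟩
        have h₁ := C'.index_toFun C e x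
        rw [hx, Subgroup.index_top] at h₁
        exact Subgroup.index_eq_one.1 h₁
      rad := by
        rintro N J J' ⟨k, x, rfl⟩ hJ
        obtain ⟨y, hy, -⟩ := C'.exists_mem (s := (k, J')) (F'.rad (C'.mem x) hJ) (C'.index_le x) 1
        exact ⟨k, y, (C'.N_toFun_eq_iff C e _ _).2 hy⟩
      up := by
        rintro N₁ N₂ J k ⟨k', x, rfl⟩ hle hn hk
        obtain ⟨H, hH, hrel⟩ := C'.exists_corr C e x
        have hx := hrel _ x le_rfl
        -- N₂ is pulled back to the group of the subsystem, where upward closure is available, and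
        -- the subgroup so obtained is then carried forward again.
        let N' := corrImage (corrInv H) N₂
        have hmem : ∀ p ∈ H, p.1 ∈ N' ↔ p.2 ∈ N₂ := by
          intro p hp
          rw [mem_corrImage]
          constructor
          · rintro ⟨g, hg, hpg⟩
            have h₁ := hle ((hx.mem_N hH (H.mul_mem (H.inv_mem hpg) hp)).1 (by simp))
            simpa using N₂.mul_mem hg h₁
          · exact fun h => ⟨p.2, h, hp⟩
        have hle' : C'.N x ≤ N' := by
          intro g hg
          obtain ⟨h, hp⟩ := hH.1 g
          exact (hmem _ hp).2 (hle ((hx.mem_N hH hp).1 hg))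
        have hF := F'.up k (C'.mem x) hle' (hH.inv.corrImage_normal hn)
          (by rwa [← C'.index_toFun C e x])
        let m : ℕ+ := ⟨N'.index, Nat.pos_of_ne_zero (F'.index_ne hF)⟩
        obtain ⟨z, hz, -⟩ := C'.exists_mem (s := (m, Jsub k J)) hF le_rfl 1
        refine ⟨m, z, ?_⟩
        have hzr := hrel _ z (by rwa [hz])
        rw [← hzr.corrImage_N hH, hz]
        exact corrImage_eq hH hmem
      inf := by
        rintro _ _ J₁ J₂ ⟨k₁, x₁, rfl⟩ ⟨k₂, x₂, rfl⟩
        have hF := F'.inf (C'.mem x₁) (C'.mem x₂)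
        let m : ℕ+ := ⟨_, Nat.pos_of_ne_zero (F'.index_ne hF)⟩
        obtain ⟨z, hz, -⟩ := C'.exists_mem (s := (m, J₁.append J₂)) hF le_rfl 1
        refine ⟨m, z, ?_⟩
        obtain ⟨H, hH, hrel⟩ := C'.exists_corr C e z
        have h₁ := hrel _ x₁ (by rw [hz]; exact inf_le_left)
        have h₂ := hrel _ x₂ (by rw [hz]; exact inf_le_right)
        rw [← (hrel _ z le_rfl).corrImage_N hH, hz]
        refine corrImage_eq hH fun p hp => ?_
        rw [Subgroup.mem_inf, Subgroup.mem_inf, h₁.mem_N hH hp, h₂.mem_N hH hp] }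
  refine ⟨F₁, hM, fun s x => ⟨fun hx => ⟨s.1, ⟨x, hx⟩, rfl⟩, ?_⟩⟩
  rintro ⟨k, x₀, hx₀⟩
  -- The witness x₀ may live in a sort with another bound. Since the index is preserved, the same
  -- subgroup also occurs in the sort of x.
  have hidx : (C'.N x₀).index ≤ s.1 := by
    rw [← C'.index_toFun C e x₀, hx₀]
    exact C.index_le x
  obtain ⟨y₀, hy₀, -⟩ := C'.exists_mem (s := s) (C'.mem x₀) hidx 1
  obtain ⟨g, hg⟩ := C.nonempty x
  obtain ⟨y, hy, hgy⟩ := C'.exists_toFun_mem C e y₀ g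
  have : e.toFun s y = x :=
    C.ext (((C'.N_toFun_eq_iff C e _ _).2 (hy.trans hy₀)).trans hx₀) hgy hg
  rw [← this]
  exact y.2

end Subsystem
end Coord

/-! ### Finitely generated subsystems -/

/-- The sorting data generated by a relation. -/
inductive Gen (Jsub : ℕ+ → Tuple 𝒥 → Tuple 𝒥) {G : Type u} [Group G]
    (X : Subgroup G → Tuple 𝒥 → Prop) : Subgroup G → Tuple 𝒥 → Prop
  | base {N J} : X N J → Gen Jsub X N J
  | top (J) : Gen Jsub X ⊤ J
  | rad {N J J'} : Gen Jsub X N J → J' ∈ J.rad → Gen Jsub X N J'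
  | up {N₁ N₂ J} (k : ℕ+) : Gen Jsub X N₁ J → N₁ ≤ N₂ → N₂.Normal → N₁.index ≤ k →
      Gen Jsub X N₂ (Jsub k J)
  | inf {N₁ N₂ J₁ J₂} : Gen Jsub X N₁ J₁ → Gen Jsub X N₂ J₂ →
      Gen Jsub X (N₁ ⊓ N₂) (J₁.append J₂)

section Gen
variable {G : Type u} [Group G] {F : SortedFilter Jsub G} {X : Subgroup G → Tuple 𝒥 → Prop}

theorem Gen.mem (hX : ∀ N J, X N J → F.Mem N J) {N J} (h : Gen Jsub X N J) : F.Mem N J := by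
  induction h with
  | base h => exact hX _ _ h
  | top J => exact F.top J
  | rad _ h ih => exact F.rad ih h
  | up k _ h₁ h₂ h₃ ih => exact F.up k ih h₁ h₂ h₃
  | inf _ _ ih₁ ih₂ => exact F.inf ih₁ ih₂

theorem Gen.le {N₀ : Subgroup G} (hX : ∀ N J, X N J → N₀ ≤ N) {N J} (h : Gen Jsub X N J) :
    N₀ ≤ N := by
  induction h with
  | base h => exact hX _ _ h
  | top J => exact le_top
  | rad _ _ ih => exact ih
  | up _ _ h₁ _ _ ih => exact ih.trans h₁
  | inf _ _ ih₁ ih₂ => exact le_inf ih₁ ih₂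

/-- The sorted filter generated by a relation. -/
def SortedFilter.gen (F : SortedFilter Jsub G) (hX : ∀ N J, X N J → F.Mem N J) :
    SortedFilter Jsub G where
  Mem := Gen Jsub X
  inhabited := F.inhabited
  normal h := F.normal (h.mem hX)
  index_ne h := F.index_ne (h.mem hX)
  top := .top
  rad := .rad
  up := .up
  inf := .inf

/-- The image of a generated sorting data under a correspondence. -/
theorem Gen.corrImage {G' : Type u} [Group G'] {F' : SortedFilter Jsub G'}
    {H : Subgroup (G × G')} (hH : BiSurj H)
    (hX : ∀ N J, X N J → (∀ g, (g, (1 : G')) ∈ H → g ∈ N) ∧ F'.Mem (corrImage H N) J)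
    {N J} (h : Gen Jsub X N J) :
    (∀ g, (g, (1 : G')) ∈ H → g ∈ N) ∧ F'.Mem (SortedSystem.corrImage H N) J := by
  induction h with
  | base h => exact hX _ _ h
  | top J => exact ⟨fun _ _ => trivial, by rw [hH.corrImage_top]; exact F'.top J⟩
  | rad _ h ih => exact ⟨ih.1, F'.rad ih.2 h⟩
  | up k _ h₁ h₂ h₃ ih =>
    refine ⟨fun g hg => h₁ (ih.1 g hg), F'.up k ih.2 (corrImage_mono h₁) ?_ ?_⟩
    · exact hH.corrImage_normal h₂
    · rwa [hH.corrImage_index ih.1]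
  | inf _ _ ih₁ ih₂ =>
    refine ⟨fun g hg => ⟨ih₁.1 g hg, ih₂.1 g hg⟩, ?_⟩
    rw [corrImage_inf ih₁.1]
    exact F'.inf ih₁.2 ih₂.2

end Gen

/-- A structure with coordinates whose filter has a least subgroup is a sorted complete system. -/
theorem Coord.isSCS {G : Type u} [Group G] {F : SortedFilter Jsub G} {S : Str 𝒥} (C : Coord F S)
    {N₀ : Subgroup G} {J₀ : Tuple 𝒥} (h₀ : F.Mem N₀ J₀) (hle : ∀ N J, F.Mem N J → N₀ ≤ N) :
    IsSCS Jsub S := by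
  have hn : N₀.Normal := F.normal h₀
  have hfi : N₀.FiniteIndex := ⟨F.index_ne h₀⟩
  have hfin : Finite (G ⧸ N₀) := Subgroup.finite_quotient_of_finiteIndex
  -- Every subgroup of the filter contains N₀, so the finite quotient by N₀ carries the whole
  -- structure, and in its discrete topology every subgroup is open.
  let Q : ProfiniteGrp.{u} := ProfiniteGrp.ofFiniteGrp (FiniteGrp.of (G ⧸ N₀))
  have : DiscreteTopology Q := ⟨rfl⟩
  let π : G →* Q := QuotientGroup.mk' N₀
  have hπ : Function.Surjective π := QuotientGroup.mk'_surjective N₀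
  have hπle : ∀ N : Subgroup Q, N₀ ≤ N.comap π := by
    intro N g hg
    have : π g = 1 := (QuotientGroup.eq_one_iff g).2 hg
    rw [Subgroup.mem_comap, this]
    exact N.one_mem
  let D : SortingData Jsub Q :=
    { F := fun N => {J | F.Mem ((N : Subgroup Q).comap π) J}
      nonempty := by
        intro N
        let m : ℕ+ := ⟨N₀.index, Nat.pos_of_ne_zero (F.index_ne h₀)⟩
        exact ⟨Jsub m J₀, F.up m h₀ (hπle _) inferInstance le_rfl⟩
      whole := by
        intro N hN
        ext J
        simp only [Set.mem_ofPred_eq, hN, Subgroup.comap_top, Set.mem_univ, iff_true]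
        exact F.top J
      rad_iff := fun N J => ⟨fun h J' hJ' => F.rad h hJ', fun h => h J.self_mem_rad⟩
      -- Permuted tuples have the same entries, so this is a case of closure under enlarging the set
      -- of entries.
      perm := by
        intro N J J' hp
        constructor <;> intro h <;> refine F.rad h fun j hj => ?_
        · exact hp.mem_iff.1 hj
        · exact hp.mem_iff.2 hj
      mono := by
        intro N₁ N₂ k J hle hk h
        exact F.up k h (Subgroup.comap_mono hle) inferInstance
          (by rwa [Subgroup.index_comap_of_surjective _ hπ])
      inter := fun N₁ N₂ J₁ J₂ h₁ h₂ => F.inf h₁ h₂ }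
  let H : Subgroup (Q × G) := (MonoidHom.mk' (fun g : G => (π g, g)) (by simp)).range
  have hmem : ∀ p, p ∈ H ↔ π p.2 = p.1 := by
    rintro ⟨q, g⟩
    constructor
    · rintro ⟨g', hg'⟩
      cases hg'
      rfl
    · rintro h
      exact ⟨g, Prod.ext h rfl⟩
  have hH : BiSurj H := by
    constructor
    · intro q
      obtain ⟨g, hg⟩ := hπ q
      exact ⟨g, (hmem _).2 hg⟩
    · exact fun g => ⟨π g, (hmem _).2 rfl⟩
  have himg : ∀ N : Subgroup Q, corrImage H N = N.comap π := by
    intro N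
    refine corrImage_eq hH fun p hp => ?_
    rw [Subgroup.mem_comap, (hmem p).1 hp]
  have hex : ∀ s (x : (completeSystem Q D).carrier s), ∃ y : S.carrier s,
      (completeSystemCoord D).Rel C H x y := by
    intro s x
    refine Coord.exists_rel _ _ hH x ?_ ?_
    · intro q hq
      have := (hmem _).1 hq
      simp only [map_one] at this
      rw [← this]
      exact Subgroup.one_mem _
    · rw [himg]
      obtain ⟨N, hN, hJ⟩ := (completeSystemCoord D).mem x
      rw [← hN]
      exact hJ
  choose f hf using hex
  refine ⟨Q, D, ⟨Coord.iso hH f hf fun s y => ?_⟩⟩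
  have hcomap : (corrImage (corrInv H) (C.N y)).comap π = C.N y := by
    ext g
    rw [Subgroup.mem_comap, mem_corrImage]
    constructor
    · rintro ⟨g', hg', hp⟩
      have h₁ : π g' = π g := (hmem _).1 hp
      have h₂ : g'⁻¹ * g ∈ N₀ := QuotientGroup.eq.1 h₁
      simpa using (C.N y).mul_mem hg' (hle _ _ (C.mem y) h₂)
    · exact fun hg => ⟨g, hg, (hmem _).2 rfl⟩
  obtain ⟨x, hx⟩ := Coord.exists_rel C (completeSystemCoord D) hH.inv y (by
      intro g hg
      have h₁ : π g = 1 := (hmem _).1 hg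
      exact hle _ _ (C.mem y) ((QuotientGroup.eq_one_iff g).1 h₁)) (by
      let N : OpenNormalSubgroup Q :=
        { toSubgroup := corrImage (corrInv H) (C.N y)
          isOpen' := isOpen_discrete _
          isNormal' := hH.inv.corrImage_normal (C.normal y) }
      refine ⟨N, rfl, ?_⟩
      change F.Mem ((corrImage (corrInv H) (C.N y)).comap π) s.2
      rw [hcomap]
      exact C.mem y)
  exact ⟨x, fun p hp => (hx (p.2, p.1) hp).symm⟩

/-! ### Generated subsystems in coordinates and extension of correspondences -/

namespace Coord
variable {G : Type u} [Group G] {F : SortedFilter Jsub G} {S : Str 𝒥} (C : Coord F S)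

/-- The pairs of a subgroup and a tuple that occur in a set of elements. -/
def pairs (X : Set S.Elem) (N : Subgroup G) (J : Tuple 𝒥) : Prop :=
  ∃ x ∈ X, C.N x.2 = N ∧ x.1.2 = J

theorem pairs_mem (X : Set S.Elem) : ∀ N J, C.pairs X N J → F.Mem N J := by
  rintro _ _ ⟨x, -, rfl, rfl⟩
  exact C.mem x.2

theorem pairs_le {X : Set S.Elem} {N₀ : Subgroup G} (h : ∀ x ∈ X, N₀ ≤ C.N x.2) :
    ∀ N J, C.pairs X N J → N₀ ≤ N := by
  rintro _ _ ⟨x, hx, rfl, rfl⟩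
  exact h x hx

/-- Coordinates of the subsystem generated by a set. -/
def genRestrict (X : Set S.Elem) :
    Coord (F.gen (C.pairs_mem X)) (S.induce {y | Gen Jsub (C.pairs X) (C.N y.2) y.1.2}) :=
  C.restrict (F.gen (C.pairs_mem X)) (fun _ _ h => Gen.mem (C.pairs_mem X) h) _
    fun _ _ => Iff.rfl

theorem isSubsystem_of_le {X : Set S.Elem} {N₀ : Subgroup G} {J₀ : Tuple 𝒥}
    (h₀ : Gen Jsub (C.pairs X) N₀ J₀) (hle : ∀ x ∈ X, N₀ ≤ C.N x.2) :
    IsSubsystem Jsub S {y | Gen Jsub (C.pairs X) (C.N y.2) y.1.2} :=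
  (C.genRestrict X).isSCS h₀ fun _ _ h => Gen.le (C.pairs_le hle) h

/-- An intersection of subsystems need not be a subsystem a priori. When the closure `Gen` has a
least subgroup it is one, and every subsystem containing X contains it because its filter is closed
under the same rules. -/
theorem gen_eq {X : Set S.Elem} {N₀ : Subgroup G} {J₀ : Tuple 𝒥}
    (h₀ : Gen Jsub (C.pairs X) N₀ J₀) (hle : ∀ x ∈ X, N₀ ≤ C.N x.2) :
    gen Jsub S X = {y | Gen Jsub (C.pairs X) (C.N y.2) y.1.2} := by
  apply Set.Subset.antisymm
  · exact Set.sInter_subset_of_mem ⟨C.isSubsystem_of_le h₀ hle, fun x hx => .base ⟨x, hx, rfl, rfl⟩⟩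
  · rintro ⟨s, y⟩ hy A ⟨hA, hXA⟩
    obtain ⟨F₁, -, h₁⟩ := C.exists_sortedFilter hA
    refine (h₁ s y).2 (Gen.mem (F := F₁) ?_ hy)
    rintro _ _ ⟨x, hx, rfl, rfl⟩
    exact (h₁ _ _).1 (hXA hx)

/-- Intersect the subgroups of Y one at a time. The generating set X stays fixed while Y grows in
the induction. -/
theorem exists_gen_le {X Y : Set S.Elem} (hY : Y.Finite) (hX : Y ⊆ X) :
    ∃ N₀ J₀, Gen Jsub (C.pairs X) N₀ J₀ ∧ ∀ x ∈ Y, N₀ ≤ C.N x.2 := by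
  induction Y, hY using Set.Finite.induction_on with
  | empty =>
    obtain ⟨J⟩ := F.inhabited
    exact ⟨⊤, J, .top J, by simp⟩
  | @insert a Y _ _ ih =>
    obtain ⟨N₀, J₀, h, hle⟩ := ih ((Set.subset_insert _ _).trans hX)
    refine ⟨N₀ ⊓ C.N a.2, _, .inf h (.base ⟨a, hX (Set.mem_insert _ _), rfl, rfl⟩), ?_⟩
    rintro x (rfl | hx)
    · exact inf_le_right
    · exact inf_le_left.trans (hle x hx)

theorem isFGSubsystem_gen (C : Coord F S) {X : Set S.Elem} (hX : X.Finite) :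
    IsFGSubsystem Jsub S (gen Jsub S X) := by
  obtain ⟨N₀, J₀, h₀, hle⟩ := C.exists_gen_le hX Set.Subset.rfl
  refine ⟨?_, X, hX, rfl⟩
  rw [C.gen_eq h₀ hle]
  exact C.isSubsystem_of_le h₀ hle

/-- An embedding of a finitely generated subsystem is given by a correspondence. -/
theorem exists_corr_gen {G' : Type u} [Group G'] {F' : SortedFilter Jsub G'} {S' : Str 𝒥}
    (C' : Coord F' S') {X : Set S.Elem} {N₀ : Subgroup G} {J₀ : Tuple 𝒥}
    (h₀ : Gen Jsub (C.pairs X) N₀ J₀) (hle : ∀ x ∈ X, N₀ ≤ C.N x.2)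
    (ψ : Embedding (S.induce (gen Jsub S X)) S') :
    ∃ H : Subgroup (G × G'), BiSurj H ∧
      ∀ s (y : (S.induce (gen Jsub S X)).carrier s), C.Rel C' H y.1 (ψ.toFun s y) := by
  have hg : ∀ s (x : S.carrier s), (⟨s, x⟩ : S.Elem) ∈ gen Jsub S X ↔
      Gen Jsub (C.pairs X) (C.N x) s.2 := by
    rw [C.gen_eq h₀ hle]
    exact fun _ _ => Iff.rfl
  let D := C.restrict (F.gen (C.pairs_mem X)) (fun _ _ h => Gen.mem (C.pairs_mem X) h) _ hg
  -- The sort is chosen to hold a coset z of the least subgroup N₀; the correspondence at z then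
  -- covers the whole subsystem.
  let m : ℕ+ := ⟨N₀.index, Nat.pos_of_ne_zero (F.index_ne (h₀.mem (C.pairs_mem X)))⟩
  obtain ⟨z, hz, -⟩ := D.exists_mem (s := (m, J₀)) h₀ le_rfl 1
  obtain ⟨H, hH, hrel⟩ := D.exists_corr C' ψ z
  refine ⟨H, hH, fun s y => hrel s y ?_⟩
  rw [hz]
  exact Gen.le (C.pairs_le hle) (D.mem y)

/-- Co-SEP extends finite partial correspondences. -/
theorem extend (hS : CoSEP Jsub S) {H : Subgroup (G × G)} (hH : BiSurj H)
    {X : Set (Σ s, S.carrier s × S.carrier s)} (hX : X.Finite)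
    (hr : ∀ p ∈ X, C.Rel C H p.2.1 p.2.2) {s : Idx 𝒥} (x : S.carrier s) :
    ∃ (x' : S.carrier s) (H' : Subgroup (G × G)), BiSurj H' ∧ C.Rel C H' x x' ∧
      ∀ p ∈ X, C.Rel C H' p.2.1 p.2.2 := by
  let Y : Set S.Elem := (fun p => ⟨p.1, p.2.1⟩) '' X
  have hY : Y.Finite := hX.image _
  let Z : Set S.Elem := insert ⟨s, x⟩ Y
  have hZ : Z.Finite := hY.insert _
  obtain ⟨N₁, J₁, h₁, hle₁⟩ := C.exists_gen_le hY Set.Subset.rfl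
  obtain ⟨N₂, J₂, h₂, hle₂⟩ := C.exists_gen_le hZ Set.Subset.rfl
  have hg : ∀ s (x : S.carrier s), (⟨s, x⟩ : S.Elem) ∈ gen Jsub S Y ↔
      Gen Jsub (C.pairs Y) (C.N x) s.2 := by
    rw [C.gen_eq h₁ hle₁]
    exact fun _ _ => Iff.rfl
  let D := C.restrict (F.gen (C.pairs_mem Y)) (fun _ _ h => Gen.mem (C.pairs_mem Y) h) _ hg
  have hex : ∀ t (y : (S.induce (gen Jsub S Y)).carrier t), ∃ y' : S.carrier t,
      D.Rel C H y y' := by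
    intro t y
    obtain ⟨h₃, h₄⟩ := Gen.corrImage (F' := F) hH (by
      rintro _ _ ⟨_, ⟨p, hp, rfl⟩, rfl, rfl⟩
      refine ⟨fun g => (hr p hp).of_one hH, ?_⟩
      rw [(hr p hp).corrImage_N hH]
      exact C.mem _) (D.mem y)
    exact Coord.exists_rel D C hH y h₃ h₄
  choose f hf using hex
  have hsub : gen Jsub S Y ⊆ gen Jsub S Z := gen_mono Jsub S (Set.subset_insert _ _)
  -- Co-SEP is applied with Π the inclusion of the subsystem generated by Y into the one generated
  -- by Z, and Φ the embedding induced by H.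
  obtain ⟨ψ, hψ⟩ := hS _ _ (C.isFGSubsystem_gen hZ) (C.isFGSubsystem_gen hY)
    { toFun := fun _ y => ⟨y.1, hsub y.2⟩
      injective := fun _ y z h => Subtype.ext (Subtype.mk.inj h)
      le_iff := fun _ _ => Iff.rfl
      C_iff := fun _ _ => Iff.rfl
      P_iff := fun _ _ _ => Iff.rfl } (embedding hH f hf)
  obtain ⟨H', hH', hrel⟩ := C.exists_corr_gen C h₂ hle₂ ψ
  refine ⟨_, H', hH', hrel s ⟨x, subset_gen Jsub S _ (Set.mem_insert _ _)⟩, fun p hp => ?_⟩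
  have hpY : (⟨p.1, p.2.1⟩ : S.Elem) ∈ gen Jsub S Y := subset_gen Jsub S _ ⟨p, hp, rfl⟩
  have h₃ := hrel p.1 ⟨p.2.1, hsub hpY⟩
  have h₄ := hψ p.1 ⟨p.2.1, hpY⟩
  -- H' need not contain or be contained in H. Both send the given elements to the same images
  -- because ψ extends f and a related element of a given sort is unique.
  have h₅ : f p.1 ⟨p.2.1, hpY⟩ = p.2.2 :=
    ((show C.Rel C H p.2.1 _ from hf p.1 ⟨p.2.1, hpY⟩).eq_iff hH (hr p hp)).2 rfl
  change ψ.toFun _ _ = f _ _ at h₄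
  rw [h₄, h₅] at h₃
  exact h₃

end Coord

/-! ### Variables, environments and substitution -/

section Logic
variable {M S : Str 𝒥} {Γ Δ Θ : List (Idx 𝒥)} {s : Idx 𝒥} {K : Idx 𝒥 → Type u}

/-- The environment with given values. -/
def Env.ofFun : (Γ : List (Idx 𝒥)) → (∀ s, Var Γ s → M.carrier s) → Env M Γ
  | [], _ => PUnit.unit
  | s :: Γ, f => (f s .zero, Env.ofFun Γ fun t x => f t x.succ)

theorem Var.eval_ofFun (f : ∀ s, Var Γ s → M.carrier s) (x : Var Γ s) :
    x.eval (Env.ofFun Γ f) = f s x := by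
  induction x with
  | zero => rfl
  | succ x ih => exact ih _

/-- Concatenation of environments. -/
def Env.append : {Γ : List (Idx 𝒥)} → Env M Γ → Env M Δ → Env M (Γ ++ Δ)
  | [], _, w => w
  | _ :: _, v, w => (v.1, Env.append v.2 w)

/-- Variables of the first part of a concatenation. -/
def Var.inl : {Γ : List (Idx 𝒥)} → {s : Idx 𝒥} → Var Γ s → Var (Γ ++ Δ) s
  | _, _, .zero => .zero
  | _, _, .succ x => .succ x.inl

/-- Variables of the second part of a concatenation. -/
def Var.inr : (Γ : List (Idx 𝒥)) → {s : Idx 𝒥} → Var Δ s → Var (Γ ++ Δ) s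
  | [], _, x => x
  | _ :: Γ, _, x => .succ (Var.inr Γ x)

theorem Var.eval_inl (v : Env M Γ) (w : Env M Δ) (x : Var Γ s) :
    (x.inl : Var (Γ ++ Δ) s).eval (v.append w) = x.eval v := by
  induction x with
  | zero => rfl
  | succ x ih => exact ih v.2

theorem Var.eval_inr (v : Env M Γ) (w : Env M Δ) (x : Var Δ s) :
    (Var.inr Γ x).eval (v.append w) = x.eval w := by
  induction Γ with
  | nil => rfl
  | cons t Γ ih => exact ih v.2

/-- A variable of a concatenation belongs to one of the two parts. -/
theorem Var.eq_inl_or_inr (x : Var (Γ ++ Δ) s) :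
    (∃ y : Var Γ s, x = y.inl) ∨ ∃ y : Var Δ s, x = Var.inr Γ y := by
  induction Γ with
  | nil => exact .inr ⟨x, rfl⟩
  | cons t Γ ih =>
    cases x with
    | zero => exact .inl ⟨.zero, rfl⟩
    | succ x =>
      obtain ⟨y, rfl⟩ | ⟨y, rfl⟩ := ih x
      · exact .inl ⟨.succ y, rfl⟩
      · exact .inr ⟨y, rfl⟩

theorem Env.ext {v w : Env M Γ} (h : ∀ s (x : Var Γ s), x.eval v = x.eval w) : v = w := by
  induction Γ with
  | nil => rfl
  | cons t Γ ih => exact Prod.ext (h t .zero) (ih fun s x => h s x.succ)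

theorem Var.finite (Γ : List (Idx 𝒥)) : Finite (Σ s, Var Γ s) := by
  induction Γ with
  | nil =>
    have : IsEmpty (Σ s : Idx 𝒥, Var [] s) := ⟨fun x => nomatch x.2⟩
    infer_instance
  | cons t Γ ih =>
    refine Finite.of_surjective (α := Option (Σ s, Var Γ s))
      (fun o => o.elim ⟨t, .zero⟩ fun x => ⟨x.1, x.2.succ⟩) ?_
    rintro ⟨s, x⟩
    cases x with
    | zero => exact ⟨none, rfl⟩
    | succ x => exact ⟨some ⟨s, x⟩, rfl⟩

/-- Formulas without constant symbols. -/
abbrev PureFormula (Γ : List (Idx 𝒥)) : Type u := Formula (fun _ : Idx 𝒥 => PEmpty.{u + 1}) Γ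

/-- Satisfaction of formulas without constant symbols. -/
def Sat (φ : PureFormula Γ) (v : Env M Γ) : Prop := Formula.Realize (fun _ c => c.elim) φ v

/-- The type of a tuple over the empty set. -/
def typeOf (v : Env M Γ) : Set (PureFormula Γ) := {φ | Sat φ v}

/-- Weakening of a term by a variable. -/
def Term.weaken (t : Idx 𝒥) : Term K Γ s → Term K (t :: Γ) s
  | .var x => .var x.succ
  | .const c => .const c

/-- Extension of a substitution to a context with one more variable. -/
def liftSubst (σ : ∀ s, Var Γ s → Term K Δ s) (t : Idx 𝒥) :
    ∀ s, Var (t :: Γ) s → Term K (t :: Δ) s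
  | _, .zero => .var .zero
  | s, .succ x => (σ s x).weaken t

/-- Substitution in terms. -/
def Term.subst (σ : ∀ s, Var Γ s → Term K Δ s) :
    Term (fun _ => PEmpty.{u + 1}) Γ s → Term K Δ s
  | .var x => σ s x
  | .const c => c.elim

/-- Substitution of terms for variables. -/
def Formula.subst : {Γ Δ : List (Idx 𝒥)} → (∀ s, Var Γ s → Term K Δ s) → PureFormula Γ →
    Formula K Δ
  | _, _, _, .falsum => .falsum
  | _, _, σ, .equal x y => .equal (x.subst σ) (y.subst σ)
  | _, _, σ, .le x y => .le (x.subst σ) (y.subst σ)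
  | _, _, σ, .C x y => .C (x.subst σ) (y.subst σ)
  | _, _, σ, .P x y z => .P (x.subst σ) (y.subst σ) (z.subst σ)
  | _, _, σ, .imp φ ψ => .imp (φ.subst σ) (ψ.subst σ)
  | _, _, σ, .all s φ => .all s (φ.subst (liftSubst σ s))

variable {ι : ∀ s, K s → M.carrier s}

theorem Term.eval_subst {σ : ∀ s, Var Γ s → Term K Δ s} {v : Env M Γ} {w : Env M Δ}
    (h : ∀ s (x : Var Γ s), (σ s x).eval ι w = x.eval v)
    (t : Term (fun _ => PEmpty.{u + 1}) Γ s) :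
    (t.subst σ).eval ι w = t.eval (fun _ c => c.elim) v := by
  cases t with
  | var x => exact h s x
  | const c => exact c.elim

theorem Formula.realize_subst {σ : ∀ s, Var Γ s → Term K Δ s} {v : Env M Γ} {w : Env M Δ}
    (h : ∀ s (x : Var Γ s), (σ s x).eval ι w = x.eval v) (φ : PureFormula Γ) :
    (φ.subst σ).Realize ι w ↔ Sat φ v := by
  unfold Sat
  induction φ generalizing Δ with
  | falsum => rfl
  | equal x y => simp only [Formula.subst, Formula.Realize, Term.eval_subst h]
  | le x y => simp only [Formula.subst, Formula.Realize, Term.eval_subst h]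
  | C x y => simp only [Formula.subst, Formula.Realize, Term.eval_subst h]
  | P x y z => simp only [Formula.subst, Formula.Realize, Term.eval_subst h]
  | imp φ ψ ih₁ ih₂ => exact imp_congr (ih₁ h) (ih₂ h)
  | all t φ ih =>
    refine forall_congr' fun a => ih fun s x => ?_
    cases x with
    | zero => rfl
    | succ x =>
      rw [show (x.succ : Var (t :: _) s).eval ((a, v) : Env M (t :: _)) = x.eval v from rfl,
        ← h s x]
      change ((σ s x).weaken t).eval ι _ = _
      cases σ s x <;> rfl

/-- Types of subtuples. -/
theorem typeOf_comap {u : Env M Θ} {u' : Env S Θ} (h : typeOf u = typeOf u') {v : Env M Γ}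
    {v' : Env S Γ} (ρ : ∀ s, Var Γ s → Var Θ s) (hv : ∀ s x, (ρ s x).eval u = x.eval v)
    (hv' : ∀ s x, (ρ s x).eval u' = x.eval v') : typeOf v = typeOf v' := by
  ext φ
  have h₁ := Formula.realize_subst (K := fun _ => PEmpty.{u + 1}) (ι := fun _ c => c.elim)
    (σ := fun s x => .var (ρ s x)) (w := u) hv φ
  have h₂ := Formula.realize_subst (K := fun _ => PEmpty.{u + 1}) (ι := fun _ c => c.elim)
    (σ := fun s x => .var (ρ s x)) (w := u') hv' φ
  have h₃ : φ.subst (fun s x => .var (ρ s x)) ∈ typeOf u ↔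
    φ.subst (fun s x => .var (ρ s x)) ∈ typeOf u' := by rw [h]
  exact h₁.symm.trans (h₃.trans h₂)

/-- Existential quantification. -/
def Formula.ex (s : Idx 𝒥) (φ : Formula K (s :: Γ)) : Formula K Γ := (Formula.all s φ.not).not

theorem Formula.realize_not (φ : Formula K Γ) (v : Env M Γ) :
    φ.not.Realize ι v ↔ ¬ φ.Realize ι v := Iff.rfl

theorem Formula.realize_ex (φ : Formula K (s :: Γ)) (v : Env M Γ) :
    (φ.ex s).Realize ι v ↔ ∃ x : M.carrier s, φ.Realize ι (x, v) := by
  rw [Formula.ex, Formula.realize_not]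
  change ¬ (∀ x, ¬ _) ↔ _
  push Not
  rfl

/-- Existential quantification over a tuple of variables. -/
def Formula.exs : (Γ : List (Idx 𝒥)) → PureFormula (Γ ++ Δ) → PureFormula Δ
  | [], φ => φ
  | s :: Γ, φ => Formula.exs Γ (Formula.ex (Γ := Γ ++ Δ) s φ)

theorem Formula.sat_exs (φ : PureFormula (Γ ++ Δ)) (w : Env M Δ) :
    Sat (φ.exs Γ) w ↔ ∃ v : Env M Γ, Sat φ (v.append w) := by
  induction Γ with
  | nil => exact ⟨fun h => ⟨PUnit.unit, h⟩, fun ⟨_, h⟩ => h⟩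
  | cons s Γ ih =>
    refine (ih _).trans ?_
    unfold Sat
    constructor
    · rintro ⟨v, hv⟩
      obtain ⟨x, hx⟩ := (Formula.realize_ex _ _).1 hv
      exact ⟨(x, v), hx⟩
    · rintro ⟨v, hv⟩
      exact ⟨v.2, (Formula.realize_ex _ _).2 ⟨v.1, hv⟩⟩

/-- The conjunction does not depend on the structure, since it is evaluated both in S and in other
models. -/
theorem exists_conj {α : Type*} [Finite α] (f : α → PureFormula Γ) :
    ∃ ψ : PureFormula Γ, ∀ (M : Str 𝒥) (v : Env M Γ), Sat ψ v ↔ ∀ i, Sat (f i) v := by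
  have key : ∀ l : List (PureFormula Γ), ∃ ψ : PureFormula Γ, ∀ (M : Str 𝒥) (v : Env M Γ),
      Sat ψ v ↔ ∀ φ ∈ l, Sat φ v := by
    intro l
    induction l with
    | nil => exact ⟨.not .falsum, fun M v => by simp [Sat, Formula.not, Formula.Realize]⟩
    | cons φ l ih =>
      obtain ⟨ψ, hψ⟩ := ih
      refine ⟨.not (.imp φ ψ.not), fun M v => ?_⟩
      rw [List.forall_mem_cons, ← hψ]
      change ¬ (Sat φ v → ¬ Sat ψ v) ↔ _
      tauto
  have := Fintype.ofFinite α
  obtain ⟨ψ, hψ⟩ := key (Finset.univ.toList.map f)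
  exact ⟨ψ, fun M v => by simp [hψ]⟩

/-- A formula that holds of one tuple and not of the others of different types. -/
theorem exists_separating (t₀ : Set (PureFormula Γ)) (h₀ : ∃ (M : Str 𝒥) (v : Env M Γ),
      t₀ = typeOf v) {t : Set (PureFormula Γ)} (ht : ∃ (M : Str 𝒥) (v : Env M Γ), t = typeOf v) :
    ∃ φ ∈ t₀, t ≠ t₀ → φ ∉ t := by
  obtain ⟨M, v, rfl⟩ := h₀
  obtain ⟨S, w, rfl⟩ := ht
  by_cases h : typeOf w = typeOf v
  · exact ⟨.not .falsum, fun h => h, fun h' => (h' h).elim⟩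
  · by_contra! hc
    refine h (Set.Subset.antisymm (fun φ hφ => ?_) fun φ hφ => (hc φ hφ).2)
    by_contra hn
    exact (hc φ.not hn).2 hφ

/-- Take the conjunction of one separating formula for each of the finitely many types of S.
Isolation is claimed only among tuples of S, while v may come from elsewhere. -/
theorem exists_isolating (hfin : (Set.range (typeOf : Env S Γ → _)).Finite) (v : Env M Γ) :
    ∃ ψ : PureFormula Γ, Sat ψ v ∧ ∀ w : Env S Γ, Sat ψ w → typeOf w = typeOf v := by
  have := hfin.to_subtype
  choose f hf hsep using fun t : Set.range (typeOf : Env S Γ → _) =>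
    exists_separating (typeOf v) ⟨M, v, rfl⟩ (t := t.1) (by
      obtain ⟨w, hw⟩ := t.2
      exact ⟨S, w, hw.symm⟩)
  obtain ⟨ψ, hψ⟩ := exists_conj f
  refine ⟨ψ, (hψ _ _).2 hf, fun w hw => ?_⟩
  by_contra h
  exact hsep ⟨_, w, rfl⟩ h ((hψ _ _).1 hw _)

/-- If `S` has finitely many types, then an extension of a tuple is matched in `S`. -/
theorem exists_typeOf_append_eq (hfin : (Set.range (typeOf : Env S (Γ ++ Δ) → _)).Finite)
    {u : Env M Δ} {u' : Env S Δ} (h : typeOf u = typeOf u') (z : Env M Γ) :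
    ∃ z' : Env S Γ, typeOf (z'.append u') = typeOf (z.append u) := by
  obtain ⟨ψ, hψ, hiso⟩ := exists_isolating hfin (z.append u)
  have h₁ : ψ.exs Γ ∈ typeOf u := (Formula.sat_exs _ _).2 ⟨z, hψ⟩
  rw [h] at h₁
  obtain ⟨z', hz'⟩ := (Formula.sat_exs _ _).1 h₁
  exact ⟨z', hiso _ hz'⟩

/-- If `S` has finitely many types, then an extension of a tuple of `S` is matched elsewhere. -/
theorem exists_typeOf_append_eq' (hfin : (Set.range (typeOf : Env S (Γ ++ Δ) → _)).Finite)
    {u : Env M Δ} {u' : Env S Δ} (h : typeOf u = typeOf u') (z' : Env S Γ) :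
    ∃ z : Env M Γ, typeOf (z'.append u') = typeOf (z.append u) := by
  obtain ⟨ψ, hψ, hiso⟩ := exists_isolating hfin (z'.append u')
  have h₁ : ψ.exs Γ ∈ typeOf u' := (Formula.sat_exs _ _).2 ⟨z', hψ⟩
  rw [← h] at h₁
  obtain ⟨z, hz⟩ := (Formula.sat_exs _ _).1 h₁
  -- ψ isolates only inside S, so the witness z in M is copied back to S before isolation is used.
  obtain ⟨z'', hz''⟩ := exists_typeOf_append_eq hfin h z
  have h₂ : ψ ∈ typeOf (z''.append u') := by
    rw [hz'']
    exact hz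
  exact ⟨z, (hiso _ h₂).symm.trans hz''⟩

theorem typeOf_nil_eq (h : ∀ σ ∈ Th S, Sentence.Holds M σ) :
    typeOf (M := M) (Γ := []) PUnit.unit = typeOf (M := S) (Γ := []) PUnit.unit := by
  ext σ
  constructor
  · intro hM
    by_contra hS
    exact h (Formula.not σ) hS hM
  · exact fun hS => h σ hS

/-! ### Constant symbols as variables -/

/-- The values of a list of constant symbols. -/
def constEnv (ι : ∀ s, K s → M.carrier s) : (l : List (Σ s, K s)) → Env M (l.map Sigma.fst)
  | [] => PUnit.unit
  | c :: l => (ι c.1 c.2, constEnv ι l)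

theorem exists_var_of_mem {l : List (Σ s, K s)} {c : Σ s, K s} (h : c ∈ l) :
    ∃ x : Var (l.map Sigma.fst) c.1, ∀ (M : Str 𝒥) (ι : ∀ s, K s → M.carrier s),
      x.eval (constEnv ι l) = ι c.1 c.2 := by
  induction l with
  | nil => cases h
  | cons d l ih =>
    rcases List.mem_cons.1 h with rfl | h
    · exact ⟨.zero, fun _ _ => rfl⟩
    · obtain ⟨x, hx⟩ := ih h
      exact ⟨x.succ, hx⟩

theorem eval_constEnv_mem (ι : ∀ s, K s → M.carrier s) (l : List (Σ s, K s))
    (x : Var (l.map Sigma.fst) s) : ∃ c : K s, ⟨s, c⟩ ∈ l ∧ x.eval (constEnv ι l) = ι s c := by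
  induction l with
  | nil => cases x
  | cons d l ih =>
    cases x with
    | zero => exact ⟨d.2, List.mem_cons_self, rfl⟩
    | succ x =>
      obtain ⟨c, hc, hx⟩ := ih x
      exact ⟨c, List.mem_cons_of_mem _ hc, hx⟩

variable (ι) in
-- Allowing every larger list l' lets the lists of several subterms be merged by concatenation.
theorem Term.exists_var (t : Term K Γ s) : ∃ l : List (Σ s, K s), ∀ l', l ⊆ l' →
    ∃ x : Var (Γ ++ l'.map Sigma.fst) s, ∀ v : Env M Γ,
      x.eval (v.append (constEnv ι l')) = t.eval ι v := by
  cases t with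
  | var x => exact ⟨[], fun l' _ => ⟨x.inl, fun v => Var.eval_inl _ _ _⟩⟩
  | const c =>
    refine ⟨[⟨s, c⟩], fun l' h => ?_⟩
    obtain ⟨x, hx⟩ := exists_var_of_mem (h List.mem_cons_self)
    exact ⟨Var.inr Γ x, fun v => (Var.eval_inr _ _ _).trans (hx M ι)⟩

variable (ι) in
/-- A formula with constant symbols comes from a formula without them. -/
theorem Formula.exists_pure (φ : Formula K Γ) : ∃ l : List (Σ s, K s), ∀ l', l ⊆ l' →
    ∃ ψ : PureFormula (Γ ++ l'.map Sigma.fst), ∀ v : Env M Γ,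
      φ.Realize ι v ↔ Sat ψ (v.append (constEnv ι l')) := by
  induction φ with
  | falsum => exact ⟨[], fun l' _ => ⟨.falsum, fun v => Iff.rfl⟩⟩
  | equal t₁ t₂ =>
    obtain ⟨l₁, h₁⟩ := t₁.exists_var ι
    obtain ⟨l₂, h₂⟩ := t₂.exists_var ι
    refine ⟨l₁ ++ l₂, fun l' h => ?_⟩
    obtain ⟨k₁, k₂⟩ := List.append_subset.1 h
    obtain ⟨x₁, hx₁⟩ := h₁ l' k₁
    obtain ⟨x₂, hx₂⟩ := h₂ l' k₂
    refine ⟨.equal (.var x₁) (.var x₂), fun v => ?_⟩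
    simp only [Sat, Formula.Realize, Term.eval, hx₁, hx₂]
  | le t₁ t₂ =>
    obtain ⟨l₁, h₁⟩ := t₁.exists_var ι
    obtain ⟨l₂, h₂⟩ := t₂.exists_var ι
    refine ⟨l₁ ++ l₂, fun l' h => ?_⟩
    obtain ⟨k₁, k₂⟩ := List.append_subset.1 h
    obtain ⟨x₁, hx₁⟩ := h₁ l' k₁
    obtain ⟨x₂, hx₂⟩ := h₂ l' k₂
    refine ⟨.le (.var x₁) (.var x₂), fun v => ?_⟩
    simp only [Sat, Formula.Realize, Term.eval, hx₁, hx₂]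
  | C t₁ t₂ =>
    obtain ⟨l₁, h₁⟩ := t₁.exists_var ι
    obtain ⟨l₂, h₂⟩ := t₂.exists_var ι
    refine ⟨l₁ ++ l₂, fun l' h => ?_⟩
    obtain ⟨k₁, k₂⟩ := List.append_subset.1 h
    obtain ⟨x₁, hx₁⟩ := h₁ l' k₁
    obtain ⟨x₂, hx₂⟩ := h₂ l' k₂
    refine ⟨.C (.var x₁) (.var x₂), fun v => ?_⟩
    simp only [Sat, Formula.Realize, Term.eval, hx₁, hx₂]
  | P t₁ t₂ t₃ =>
    obtain ⟨l₁, h₁⟩ := t₁.exists_var ι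
    obtain ⟨l₂, h₂⟩ := t₂.exists_var ι
    obtain ⟨l₃, h₃⟩ := t₃.exists_var ι
    refine ⟨l₁ ++ (l₂ ++ l₃), fun l' h => ?_⟩
    obtain ⟨k₁, h⟩ := List.append_subset.1 h
    obtain ⟨k₂, k₃⟩ := List.append_subset.1 h
    obtain ⟨x₁, hx₁⟩ := h₁ l' k₁
    obtain ⟨x₂, hx₂⟩ := h₂ l' k₂
    obtain ⟨x₃, hx₃⟩ := h₃ l' k₃
    refine ⟨.P (.var x₁) (.var x₂) (.var x₃), fun v => ?_⟩
    simp only [Sat, Formula.Realize, Term.eval, hx₁, hx₂, hx₃]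
  | imp φ₁ φ₂ ih₁ ih₂ =>
    obtain ⟨l₁, h₁⟩ := ih₁
    obtain ⟨l₂, h₂⟩ := ih₂
    refine ⟨l₁ ++ l₂, fun l' h => ?_⟩
    obtain ⟨k₁, k₂⟩ := List.append_subset.1 h
    obtain ⟨x₁, hx₁⟩ := h₁ l' k₁
    obtain ⟨x₂, hx₂⟩ := h₂ l' k₂
    exact ⟨.imp x₁ x₂, fun v => imp_congr (hx₁ v) (hx₂ v)⟩
  | all t φ ih =>
    obtain ⟨l, h₁⟩ := ih
    refine ⟨l, fun l' h => ?_⟩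
    obtain ⟨ψ, hψ⟩ := h₁ l' h
    exact ⟨.all t ψ, fun v => forall_congr' fun x => hψ (x, v)⟩

/-- A formula without constant symbols specializes to a formula with parameters. -/
theorem Formula.exists_specialize {A : Set M.Elem} (ψ : PureFormula (Γ ++ Δ)) (w : Env M Δ)
    (hw : ∀ s (x : Var Δ s), (⟨s, x.eval w⟩ : M.Elem) ∈ A) :
    ∃ φ : Formula (Param M A) Γ, ∀ v : Env M Γ,
      φ.Realize (paramVal M A) v ↔ Sat ψ (v.append w) := by
  have key : ∀ s (x : Var (Γ ++ Δ) s), ∃ t : Term (Param M A) Γ s, ∀ v : Env M Γ,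
      t.eval (paramVal M A) v = x.eval (v.append w) := by
    intro s x
    obtain ⟨y, rfl⟩ | ⟨y, rfl⟩ := x.eq_inl_or_inr
    · exact ⟨.var y, fun v => (Var.eval_inl _ _ _).symm⟩
    · exact ⟨.const ⟨y.eval w, hw s y⟩, fun v => (Var.eval_inr _ _ _).symm⟩
  choose σ hσ using key
  exact ⟨ψ.subst σ, fun v => Formula.realize_subst (fun s x => hσ s x v) ψ⟩

end Logic

/-! ### Constructing correspondences: gluing and multiplication tables -/

/-- Amalgamation of a correspondence with the identity modulo a normal subgroup. -/
theorem BiSurj.exists_amalgam {G : Type u} [Group G] {H : Subgroup (G × G)} (hH : BiSurj H)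
    {N N' N₁ : Subgroup G} (hn' : N'.Normal) (hn₁ : N₁.Normal)
    (hN : ∀ p ∈ H, p.1 ∈ N ↔ p.2 ∈ N') (h : ∀ p ∈ H, p.1⁻¹ * p.2 ∈ N ⊔ N₁)
    (h' : ∀ p ∈ H, p.1⁻¹ * p.2 ∈ N' ⊔ N₁) :
    ∃ H' : Subgroup (G × G), BiSurj H' ∧
      ∀ p ∈ H', p.1⁻¹ * p.2 ∈ N₁ ∧ ∃ n ∈ N', (p.1, p.2 * n) ∈ H := by
  -- A partner of g should equal g modulo N₁ and be a partner under H modulo N'. These demands are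
  -- compatible because H is the identity modulo N' ⊔ N₁ (used to find k) and modulo N ⊔ N₁ (used to
  -- find g).
  let R : G → G → Prop := fun g k => g⁻¹ * k ∈ N₁ ∧ ∃ n ∈ N', (g, k * n) ∈ H
  have hex₁ : ∀ g, ∃ k, R g k := by
    intro g
    obtain ⟨k, hk⟩ := hH.1 g
    have h₁ := h' _ hk
    rw [sup_comm] at h₁
    obtain ⟨m, hm, n, hnn, he⟩ := Subgroup.mem_sup_of_normal_right.1 h₁
    have hk' : k = g * m * n := by rw [mul_assoc, he]; simp
    exact ⟨g * m, by simpa using hm, n, hnn, by rw [← hk']; exact hk⟩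
  have hex₂ : ∀ k, ∃ g, R g k := by
    intro k
    obtain ⟨g, hk⟩ := hH.2 k
    obtain ⟨n, hnn, m, hm, he⟩ := Subgroup.mem_sup_of_normal_right.1 (h _ hk)
    obtain ⟨l, hl⟩ := hH.1 n
    refine ⟨g * n, ?_, l, (hN _ hl).1 hnn, H.mul_mem hk hl⟩
    have : (g * n)⁻¹ * k = m := by
      rw [mul_inv_rev, mul_assoc, ← he]
      simp
    rwa [this]
  obtain ⟨H', hH'⟩ := exists_subgroup_of_rel (R := R) (N := N' ⊓ N₁) hex₁ (by
      rintro g k g' k' ⟨h₁, n, h₂, h₃⟩ ⟨h₁', n', h₂', h₃'⟩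
      refine ⟨?_, k'⁻¹ * n * k' * n', N'.mul_mem (by simpa using hn'.conj_mem _ h₂ k'⁻¹) h₂', ?_⟩
      · have := N₁.mul_mem (hn₁.conj_mem _ h₁ g'⁻¹) h₁'
        simpa [mul_assoc] using this
      · have := H.mul_mem h₃ h₃'
        simpa [mul_assoc] using this) (by
      rintro g k k' ⟨h₁, n, h₂, h₃⟩
      constructor
      · rintro ⟨h₁', n', h₂', h₃'⟩
        constructor
        · have : (1, (k * n)⁻¹ * (k' * n')) ∈ H := by simpa using H.mul_mem (H.inv_mem h₃) h₃'
          have h₄ := (hN _ this).1 N.one_mem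
          have h₅ := N'.mul_mem (N'.mul_mem h₂ h₄) (N'.inv_mem h₂')
          simpa [mul_assoc] using h₅
        · have := N₁.mul_mem (N₁.inv_mem h₁) h₁'
          simpa [mul_assoc] using this
      · rintro ⟨h₄, h₅⟩
        refine ⟨?_, k'⁻¹ * k * n, N'.mul_mem (by simpa using N'.inv_mem h₄) h₂, ?_⟩
        · have := N₁.mul_mem h₁ h₅
          simpa [mul_assoc] using this
        · simpa [mul_assoc] using h₃)
  refine ⟨H', ⟨fun g => ?_, fun k => ?_⟩, fun p hp => (hH' p).1 hp⟩
  · obtain ⟨k, hk⟩ := hex₁ g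
    exact ⟨k, (hH' _).2 hk⟩
  · obtain ⟨g, hk⟩ := hex₂ k
    exact ⟨g, (hH' _).2 hk⟩

/-- Two groups whose finite quotients have the same multiplication table correspond. -/
theorem exists_corr_of_table {G : Type u} [Group G] {α : Type*} {N' : Subgroup G}
    {q q' : G → α} (hq' : ∀ g h, q' g = q' h ↔ g⁻¹ * h ∈ N')
    (hn' : N'.Normal) (hr : Set.range q = Set.range q')
    (hm : {t : α × α × α | ∃ g h, q g = t.1 ∧ q h = t.2.1 ∧ q (g * h) = t.2.2} =
      {t : α × α × α | ∃ g h, q' g = t.1 ∧ q' h = t.2.1 ∧ q' (g * h) = t.2.2}) :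
    ∃ H : Subgroup (G × G), BiSurj H ∧ ∀ p ∈ H, q p.1 = q' p.2 := by
  have hex₁ : ∀ g, ∃ h, q g = q' h := by
    intro g
    obtain ⟨h, hh⟩ : q g ∈ Set.range q' := hr ▸ Set.mem_range_self g
    exact ⟨h, hh.symm⟩
  have hex₂ : ∀ h, ∃ g, q g = q' h := by
    intro h
    exact (hr ▸ Set.mem_range_self h : q' h ∈ Set.range q)
  obtain ⟨H, hH⟩ := exists_subgroup_of_rel (R := fun g h => q g = q' h) (N := N') hex₁ (by
    intro g h g' h' h₁ h₂
    have : (q g, q g', q (g * g')) ∈ {t : α × α × α | ∃ g h, q g = t.1 ∧ q h = t.2.1 ∧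
      q (g * h) = t.2.2} := ⟨g, g', rfl, rfl, rfl⟩
    rw [hm] at this
    obtain ⟨k, k', h₃, h₄, h₅⟩ := this
    simp only at h₃ h₄ h₅
    rw [← h₅, hq']
    rw [h₁, hq'] at h₃
    rw [h₂, hq'] at h₄
    simpa [mul_assoc] using N'.mul_mem (hn'.conj_mem _ h₃ k'⁻¹) h₄) (by
    intro g h h' h₁
    rw [h₁, hq'])
  refine ⟨H, ⟨fun g => ?_, fun k => ?_⟩, fun p hp => (hH p).1 hp⟩
  · obtain ⟨k, hk⟩ := hex₁ g
    exact ⟨k, (hH _).2 hk⟩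
  · obtain ⟨g, hk⟩ := hex₂ k
    exact ⟨g, (hH _).2 hk⟩

theorem finite_range_of_factors {α β γ : Type*} [Finite β] [Nonempty γ] {f : α → γ} (d : α → β)
    (h : ∀ x y, d x = d y → f x = f y) : (Set.range f).Finite := by
  classical
  refine (Set.finite_range (Function.extend d f fun _ => Classical.arbitrary γ)).subset ?_
  rintro _ ⟨x, rfl⟩
  exact ⟨d x, Function.FactorsThrough.extend_apply (fun a b hab => h a b hab) _ x⟩

/-! ### Back-and-forth, and types as correspondences -/

namespace Coord
variable {G : Type u} [Group G] {F : SortedFilter Jsub G} {S : Str 𝒥} (C : Coord F S)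
  {Γ Δ : List (Idx 𝒥)}

/-- Two environments correspond. -/
def RelEnv (H : Subgroup (G × G)) (v v' : Env S Γ) : Prop :=
  ∀ s (x : Var Γ s), C.Rel C H (x.eval v) (x.eval v')

variable {C} in
theorem RelEnv.symm {H : Subgroup (G × G)} {v v' : Env S Γ} (h : C.RelEnv H v v') :
    C.RelEnv (corrInv H) v' v := fun s x => (h s x).symm

/-- Extension of corresponding environments by one element. -/
theorem extend_env (hS : CoSEP Jsub S) {H : Subgroup (G × G)} (hH : BiSurj H) {v v' : Env S Γ}
    (h : C.RelEnv H v v') {s : Idx 𝒥} (x : S.carrier s) :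
    ∃ (x' : S.carrier s) (H' : Subgroup (G × G)), BiSurj H' ∧
      C.RelEnv H' (Γ := s :: Γ) (x, v) (x', v') := by
  have := Var.finite Γ
  obtain ⟨x', H', hH', h₁, h₂⟩ := C.extend hS hH
    (X := Set.range fun y : Σ s, Var Γ s => ⟨y.1, y.2.eval v, y.2.eval v'⟩)
    (Set.finite_range _) (by rintro _ ⟨y, rfl⟩; exact h y.1 y.2) x
  refine ⟨x', H', hH', fun t y => ?_⟩
  cases y with
  | zero => exact h₁
  | succ y => exact h₂ _ ⟨⟨t, y⟩, rfl⟩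

/-- Back-and-forth by induction on the formula: at a quantifier, co-SEP extends the correspondence
or its inverse by the new element. -/
theorem sat_iff_of_relEnv (hS : CoSEP Jsub S) {H : Subgroup (G × G)} (hH : BiSurj H)
    {v v' : Env S Γ} (h : C.RelEnv H v v') (φ : PureFormula Γ) : Sat φ v ↔ Sat φ v' := by
  have ht : ∀ {Γ} {v v' : Env S Γ} {H : Subgroup (G × G)}, C.RelEnv H v v' → ∀ s
      (t : Term (fun _ : Idx 𝒥 => PEmpty.{u + 1}) Γ s),
      C.Rel C H (t.eval (fun _ c => c.elim) v) (t.eval (fun _ c => c.elim) v') := by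
    intro Γ v v' H h s t
    cases t with
    | var x => exact h s x
    | const c => exact c.elim
  unfold Sat
  induction φ generalizing H with
  | falsum => rfl
  | equal t₁ t₂ => exact ((ht h _ t₁).eq_iff hH (ht h _ t₂)).symm
  | le t₁ t₂ =>
    refine (C.le_iff _ _).trans (Iff.trans ?_ (C.le_iff _ _).symm)
    exact ((ht h _ t₁).le_iff hH (ht h _ t₂)).symm
  | C t₁ t₂ =>
    refine (C.C_iff _ _).trans (Iff.trans ?_ (C.C_iff _ _).symm)
    exact ((ht h _ t₁).subset_iff hH (ht h _ t₂)).symm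
  | P t₁ t₂ t₃ => exact ((ht h _ t₁).P_iff hH (ht h _ t₂) (ht h _ t₃)).symm
  | imp φ₁ φ₂ ih₁ ih₂ => exact imp_congr (ih₁ hH h) (ih₂ hH h)
  | all s φ ih =>
    constructor
    · intro hx x'
      obtain ⟨x, H', hH', h'⟩ := C.extend_env hS hH.inv h.symm x'
      exact (ih hH'.inv h'.symm).1 (hx x)
    · intro hx x
      obtain ⟨x', H', hH', h'⟩ := C.extend_env hS hH h x
      exact (ih hH' h').2 (hx x')

theorem typeOf_eq_of_relEnv (hS : CoSEP Jsub S) {H : Subgroup (G × G)} (hH : BiSurj H)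
    {v v' : Env S Γ} (h : C.RelEnv H v v') : typeOf v = typeOf v' := by
  ext φ
  exact C.sat_iff_of_relEnv hS hH h φ

/-- The intersection of the subgroups of a tuple. -/
def nInf (v : Env S Γ) : Subgroup G := ⨅ x : Σ s, Var Γ s, C.N (x.2.eval v)

theorem mem_nInf {v : Env S Γ} {g : G} :
    g ∈ C.nInf v ↔ ∀ s (x : Var Γ s), g ∈ C.N (x.eval v) := by
  rw [nInf, Subgroup.mem_iInf]
  exact ⟨fun h s x => h ⟨s, x⟩, fun h x => h x.1 x.2⟩

theorem nInf_le (v : Env S Γ) {s : Idx 𝒥} (x : Var Γ s) : C.nInf v ≤ C.N (x.eval v) :=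
  fun _ hg => C.mem_nInf.1 hg s x

theorem nInf_normal (v : Env S Γ) : (C.nInf v).Normal :=
  Subgroup.normal_iInf_normal fun x => C.normal (x.2.eval v)

theorem nInf_index_ne (v : Env S Γ) : (C.nInf v).index ≠ 0 := by
  have := Var.finite Γ
  exact Subgroup.index_iInf_ne_zero fun x => C.index_ne (x.2.eval v)

/-- The index of an intersection is at most the product of the indices, which the sorts bound. Hence
B depends on the sorts only, the source of all finiteness below. -/
theorem exists_index_nInf_le (Γ : List (Idx 𝒥)) :
    ∃ B, ∀ v : Env S Γ, (C.nInf v).index ≤ B := by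
  have := Var.finite Γ
  have := Fintype.ofFinite (Σ s, Var Γ s)
  refine ⟨∏ x : Σ s, Var Γ s, (x.1.1 : ℕ), fun v => (Subgroup.index_iInf_le _).trans ?_⟩
  exact Finset.prod_le_prod' fun x _ => C.index_le (x.2.eval v)

/-- A subgroup of the filter below the subgroups of a tuple. -/
theorem exists_mem_le_nInf {F₁ : SortedFilter Jsub G} (v : Env S Γ)
    (hv : ∀ s (x : Var Γ s), F₁.Mem (C.N (x.eval v)) s.2) :
    ∃ N₀ J₀, F₁.Mem N₀ J₀ ∧ N₀ ≤ C.nInf v := by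
  have := Var.finite Γ
  obtain ⟨N₀, J₀, h₀, hle⟩ := C.exists_gen_le (X := Set.range fun x : Σ s, Var Γ s =>
    (⟨x.1, x.2.eval v⟩ : S.Elem)) (Set.finite_range _) Set.Subset.rfl
  refine ⟨N₀, J₀, h₀.mem ?_, fun g hg => C.mem_nInf.2 fun s x => hle _ ⟨⟨s, x⟩, rfl⟩ hg⟩
  rintro _ _ ⟨_, ⟨x, rfl⟩, rfl, rfl⟩
  exact hv _ _

variable {C} in
theorem RelEnv.mem_nInf {H : Subgroup (G × G)} (hH : BiSurj H) {v v' : Env S Γ}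
    (h : C.RelEnv H v v') {p : G × G} (hp : p ∈ H) : p.1 ∈ C.nInf v ↔ p.2 ∈ C.nInf v' := by
  rw [C.mem_nInf, C.mem_nInf]
  exact forall_congr' fun s => forall_congr' fun x => (h s x).mem_N hH hp

/-- Label the cosets of `nInf v` by elements of a fixed finite set. The labels used, the
multiplication table and the labels making up each entry of v are finite data, and equal data yield
a correspondence. -/
theorem finite_range_typeOf (C : Coord F S) (hS : CoSEP Jsub S) (Γ : List (Idx 𝒥)) :
    (Set.range (typeOf : Env S Γ → Set (PureFormula Γ))).Finite := by
  have := Var.finite Γ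
  obtain ⟨B, hB⟩ := C.exists_index_nInf_le Γ
  have hq : ∀ v : Env S Γ, ∃ q : G → Fin B, ∀ g h, q g = q h ↔ g⁻¹ * h ∈ C.nInf v := by
    intro v
    have : (C.nInf v).FiniteIndex := ⟨C.nInf_index_ne v⟩
    let e : G ⧸ C.nInf v ≃ Fin (C.nInf v).index := Finite.equivFin _
    refine ⟨fun g => Fin.castLE (hB v) (e g), fun g h => ?_⟩
    exact (Fin.castLE_injective (hB v)).eq_iff.trans (e.injective.eq_iff.trans QuotientGroup.eq)
  choose q hq using hq
  refine finite_range_of_factors (β := Set (Fin B) × Set (Fin B × Fin B × Fin B) ×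
    ((Σ s, Var Γ s) → Set (Fin B))) (fun v => (Set.range (q v),
      {t | ∃ g h, q v g = t.1 ∧ q v h = t.2.1 ∧ q v (g * h) = t.2.2},
      fun x => q v '' C.cos (x.2.eval v))) fun v v' h => ?_
  obtain ⟨h₁, h₂⟩ := Prod.ext_iff.1 h
  obtain ⟨h₂, h₃⟩ := Prod.ext_iff.1 h₂
  obtain ⟨H, hH, hHq⟩ := exists_corr_of_table (hq v') (C.nInf_normal v') h₁ h₂
  -- Each entry is a union of cosets of `nInf`, so its set of labels determines which points belong
  -- to it.
  have key : ∀ (v v' : Env S Γ) s (x : Var Γ s),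
      q v '' C.cos (x.eval v) = q v' '' C.cos (x.eval v') →
      ∀ g g', q v g = q v' g' → g ∈ C.cos (x.eval v) → g' ∈ C.cos (x.eval v') := by
    intro v v' s x he g g' hg hm
    obtain ⟨k, hk, hk'⟩ : q v g ∈ q v' '' C.cos (x.eval v') := he ▸ ⟨g, hm, rfl⟩
    rw [C.mem_cos _ hk]
    exact C.nInf_le v' x ((hq v' k g').1 (hk'.trans hg))
  refine C.typeOf_eq_of_relEnv hS hH fun s x p hp => ?_
  have h₄ := congrFun h₃ ⟨s, x⟩
  exact ⟨key v v' s x h₄ _ _ (hHq p hp), key v' v s x h₄.symm _ _ (hHq p hp).symm⟩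

/-- A tuple that enumerates all cosets of a subgroup in one sort. -/
theorem exists_enum {N₀ : Subgroup G} {s : Idx 𝒥} (h₀ : F.Mem N₀ s.2) (hs : N₀.index ≤ s.1) :
    ∃ (Δ : List (Idx 𝒥)) (w : Env S Δ), (∀ t (x : Var Δ t), t = s ∧ C.N (x.eval w) = N₀) ∧
      ∀ g, ∃ x : Var Δ s, g ∈ C.cos (x.eval w) := by
  have hfi : N₀.FiniteIndex := ⟨F.index_ne h₀⟩
  have := Fintype.ofFinite (G ⧸ N₀)
  choose z hz hmem using C.exists_mem (s := s) h₀ hs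
  let l : List S.Elem := Finset.univ.toList.map fun q : G ⧸ N₀ => ⟨s, z q.out⟩
  refine ⟨l.map Sigma.fst, constEnv (fun _ x => x) l, fun t x => ?_, fun g => ?_⟩
  · obtain ⟨c, hc, hx⟩ := eval_constEnv_mem (fun _ x => x) l x
    obtain ⟨q, -, hq⟩ := List.mem_map.1 hc
    cases hq
    exact ⟨rfl, by rw [hx, hz]⟩
  · obtain ⟨x, hx⟩ := exists_var_of_mem (l := l) (c := ⟨s, z (g : G ⧸ N₀).out⟩)
      (List.mem_map.2 ⟨_, Finset.mem_toList.2 (Finset.mem_univ _), rfl⟩)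
    refine ⟨x, ?_⟩
    have hx' : x.eval (constEnv (fun _ x => x) l) = z (g : G ⧸ N₀).out := hx S fun _ x => x
    rw [hx', C.mem_cos _ (hmem _), hz]
    exact QuotientGroup.eq.1 (g : G ⧸ N₀).out_eq'

/-- Adjoin to v an enumeration w of all cosets of a subgroup N₀ below it, and match w by w' over v'.
The matched cosets obey the same relations `P`, so relating g to the points of the match of g N₀ is
multiplicative. Comparison by `C` with this coset then handles the entries of v. -/
theorem exists_relEnv_of_typeOf_eq (hS : CoSEP Jsub S) {v v' : Env S Γ}
    (h : typeOf v = typeOf v') : ∃ H : Subgroup (G × G), BiSurj H ∧ C.RelEnv H v v' := by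
  obtain ⟨N₀, J₀, h₀, hle⟩ := C.exists_mem_le_nInf v fun _ _ => C.mem _
  let m : ℕ+ := ⟨_, Nat.pos_of_ne_zero (F.index_ne h₀)⟩
  obtain ⟨Δ, w, hw⟩ := C.exists_enum (s := (m, J₀)) h₀ le_rfl
  obtain ⟨w', hw'⟩ := exists_typeOf_append_eq (C.finite_range_typeOf hS _) h w
  obtain ⟨hwN, hw⟩ := hw
  choose x hxm using hw
  have hxN := fun g => (hwN _ (x g)).2
  let z := fun g => (x g).eval w
  let z' := fun g => (x g).eval w'
  have sat : ∀ {Θ} {u u' : Env S Θ}, typeOf u = typeOf u' → ∀ φ, Sat φ u ↔ Sat φ u' := by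
    intro Θ u u' h φ
    exact Set.ext_iff.1 h φ
  have hcon : ∀ {Θ} {u u' : Env S Θ}, typeOf u = typeOf u' → ∀ {s t} (x : Var Θ s) (y : Var Θ t),
      (S.le (x.eval u) (y.eval u) ↔ S.le (x.eval u') (y.eval u')) ∧
      (S.C (x.eval u) (y.eval u) ↔ S.C (x.eval u') (y.eval u')) :=
    fun h _ _ x y => ⟨sat h (.le (.var x) (.var y)), sat h (.C (.var x) (.var y))⟩
  have hN' : ∀ g, C.N (z' g) = C.N (z' 1) := by
    have : ∀ g k, C.N (z' g) ≤ C.N (z' k) := by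
      intro g k
      have h₁ := (hcon hw' (x g).inl (x k).inl).1
      simp only [Var.eval_inl, C.le_iff] at h₁
      exact h₁.2 ((hxN g).trans (hxN k).symm).le
    exact fun g => le_antisymm (this _ _) (this _ _)
  have hP : ∀ g k, S.P (z' g) (z' k) (z' (g * k)) := by
    intro g k
    have h₁ := sat hw' (.P (.var (x g).inl) (.var (x k).inl) (.var (x (g * k)).inl))
    simp only [Sat, Formula.Realize, Term.eval, Var.eval_inl] at h₁
    refine h₁.2 ((C.P_iff _ _ _).2 ⟨?_, ?_, g, hxm g, k, hxm k, hxm (g * k)⟩)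
    · rw [hxN, hxN]
    · rw [hxN, hxN]
  have hex₁ : ∀ g, ∃ k, k ∈ C.cos (z' g) := fun g => C.nonempty _
  -- Surjectivity: a coset through k outside the matched list would, matched in the reverse
  -- direction, give a coset of N₀ outside the full enumeration w.
  have hex₂ : ∀ k, ∃ g, k ∈ C.cos (z' g) := by
    intro k
    obtain ⟨y', hy', hk⟩ := C.exists_coset (z' 1) k
    obtain ⟨e', rfl⟩ : ∃ e' : Env S [(m, J₀)], Var.zero.eval e' = y' := ⟨(y', PUnit.unit), rfl⟩
    obtain ⟨y, hy⟩ := exists_typeOf_append_eq (C.finite_range_typeOf hS _) hw' e'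
    have h₁ := (hcon hy Var.zero.inl (Var.inr _ (x 1).inl)).1
    have h₂ := (hcon hy (Var.inr _ (x 1).inl) Var.zero.inl).1
    simp only [Var.eval_inl, Var.eval_inr, C.le_iff] at h₁ h₂
    have h₃ : C.N (Var.zero.eval y) = N₀ := by
      rw [← hxN 1]
      exact le_antisymm (h₁.2 hy'.le) (h₂.2 hy'.ge)
    obtain ⟨g, hg⟩ := C.nonempty (Var.zero.eval y)
    have h₄ : (Var.zero.eval y) = z g := C.ext (h₃.trans (hxN g).symm) hg (hxm g)
    have h₅ := sat hy (.equal (.var Var.zero.inl) (.var (Var.inr _ (x g).inl)))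
    simp only [Sat, Formula.Realize, Term.eval, Var.eval_inl, Var.eval_inr] at h₅
    have h₆ : Var.zero.eval e' = z' g := h₅.1 h₄
    exact ⟨g, h₆ ▸ hk⟩
  obtain ⟨H, hH⟩ := exists_subgroup_of_rel (R := fun g k => k ∈ C.cos (z' g)) (N := C.N (z' 1))
    hex₁ (fun h₁ h₂ => C.mul_mem_of_P (hP _ _) h₁ h₂) (by
      intro g k k' h₁
      rw [C.mem_cos _ h₁, hN'])
  refine ⟨H, ⟨fun g => ?_, fun k => ?_⟩, fun s y p hp => ?_⟩
  · obtain ⟨k, hk⟩ := hex₁ g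
    exact ⟨k, (hH _).2 hk⟩
  · obtain ⟨g, hk⟩ := hex₂ k
    exact ⟨g, (hH _).2 hk⟩
  · have h₁ := hcon hw' (x p.1).inl (Var.inr _ y)
    simp only [Var.eval_inl, Var.eval_inr, C.le_iff] at h₁
    have hle₁ : C.N (z p.1) ≤ C.N (y.eval v) := by
      rw [hxN]
      exact hle.trans (C.nInf_le v y)
    rw [← C.C_iff_of_le (hxm p.1) hle₁, ← C.C_iff_of_le ((hH p).1 hp) (h₁.1.2 hle₁)]
    exact h₁.2.symm

end Coord

/-! ### Types of elements over a subsystem -/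

theorem exists_max_of_le {α : Type*} [Nonempty α] (f : α → ℕ) (B : ℕ) (h : ∀ a, f a ≤ B) :
    ∃ a, ∀ b, f b ≤ f a := by
  obtain ⟨a, -, ha⟩ := (measure fun a => B - f a).wf.has_min Set.univ Set.univ_nonempty
  refine ⟨a, fun b => ?_⟩
  have h₁ : ¬ (B - f b < B - f a) := ha b trivial
  have h₂ := h a
  have h₃ := h b
  omega

theorem eq_of_le_of_index_le {G : Type*} [Group G] {N M : Subgroup G} (h : N ≤ M)
    (hN : N.index ≠ 0) (hi : N.index ≤ M.index) : N = M := by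
  by_contra hne
  have : N.FiniteIndex := ⟨hN⟩
  exact absurd hi (not_le_of_gt (Subgroup.index_strictAnti (lt_of_le_of_ne h hne)))

theorem sup_index_ne {G : Type*} [Group G] {N M : Subgroup G} (h : N.index ≠ 0) :
    (N ⊔ M).index ≠ 0 := fun h' => h (by
  simpa [h'] using Subgroup.index_dvd_of_le (le_sup_left : N ≤ N ⊔ M))

theorem typeOf_eq_of_tp_eq {S : Str 𝒥} {A : Set S.Elem} {s : Idx 𝒥} {a b : S.carrier s}
    (h : tp S A a = tp S A b) {Δ : List (Idx 𝒥)} (w : Env S Δ)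
    (hw : ∀ t (x : Var Δ t), (⟨t, x.eval w⟩ : S.Elem) ∈ A) :
    typeOf (Γ := s :: Δ) (a, w) = typeOf (Γ := s :: Δ) (b, w) := by
  ext ψ
  obtain ⟨φ, hφ⟩ := Formula.exists_specialize (Γ := [s]) ψ w hw
  have h₁ : φ ∈ tp S A a ↔ φ ∈ tp S A b := by rw [h]
  exact (hφ (a, PUnit.unit)).symm.trans (h₁.trans (hφ (b, PUnit.unit)))

/-- A formula mentions only finitely many parameters. -/
theorem tp_eq_of_typeOf_eq {S : Str 𝒥} {A : Set S.Elem} {s : Idx 𝒥} {a b : S.carrier s}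
    (h : ∀ (Δ : List (Idx 𝒥)) (w : Env S Δ),
      (∀ t (x : Var Δ t), (⟨t, x.eval w⟩ : S.Elem) ∈ A) →
      typeOf (Γ := s :: Δ) (a, w) = typeOf (Γ := s :: Δ) (b, w)) :
    tp S A a = tp S A b := by
  ext φ
  obtain ⟨l, hl⟩ := φ.exists_pure (paramVal S A)
  obtain ⟨ψ, hψ⟩ := hl l (List.Subset.refl l)
  have h₁ := h _ (constEnv (paramVal S A) l) fun t x => by
    obtain ⟨c, -, hx⟩ := eval_constEnv_mem (paramVal S A) l x
    rw [hx]
    exact c.2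
  have h₂ : ψ ∈ typeOf (Γ := s :: _) (a, constEnv (paramVal S A) l) ↔
    ψ ∈ typeOf (Γ := s :: _) (b, constEnv (paramVal S A) l) := by rw [h₁]
  exact (hψ (a, PUnit.unit)).trans (h₂.trans (hψ (b, PUnit.unit)).symm)

/-- The element a enters the join only through the elements d lying above a and above some member of
A. -/
theorem joinSet_subset {S : Str 𝒥} {A : Set S.Elem} {k : ℕ+} {J : Tuple 𝒥}
    {a b : S.carrier (k, J)}
    (h : ∀ x ∈ A, ∀ d : S.Elem, S.le x.2 d.2 → (S.le a d.2 ↔ S.le b d.2)) :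
    joinSet Jsub S a A ⊆ joinSet Jsub S b A := by
  rintro c ⟨k', J', x, hx, hc, hac, hxc, hmin⟩
  exact ⟨k', J', x, hx, hc, (h _ hx c hxc).1 hac, hxc,
    fun x' hx' d hbd hxd => hmin x' hx' d ((h _ hx' d hxd).2 hbd) hxd⟩

namespace Coord
variable {G : Type u} [Group G] {F : SortedFilter Jsub G} {S : Str 𝒥} (C : Coord F S)

variable {C} in
theorem Rel.refl_of {H : Subgroup (G × G)} {s : Idx 𝒥} {x : S.carrier s}
    (h : ∀ p ∈ H, p.1⁻¹ * p.2 ∈ C.N x) : C.Rel C H x x := by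
  intro p hp
  constructor
  · exact fun h₁ => (C.mem_cos _ h₁).2 (h p hp)
  · exact fun h₁ => (C.mem_cos _ h₁).2 (by simpa using (C.N x).inv_mem (h p hp))

/-- Elements with the same type over a subsystem correspond modulo each of its subgroups. -/
theorem exists_rel_of_tp_eq {A : Set S.Elem} {F₁ : SortedFilter Jsub G}
    (hA : ∀ s (x : S.carrier s), (⟨s, x⟩ : S.Elem) ∈ A ↔ F₁.Mem (C.N x) s.2) (hS : CoSEP Jsub S) {s : Idx 𝒥} {a b : S.carrier s}
    (h : tp S A a = tp S A b) {x : S.Elem} (hx : x ∈ A) :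
    ∃ H : Subgroup (G × G), BiSurj H ∧ C.Rel C H a b ∧ ∀ p ∈ H, p.1⁻¹ * p.2 ∈ C.N x.2 := by
  have hxF := (hA _ x.2).1 hx
  -- All cosets of N x in the sort of x belong to A. A correspondence fixing each of them is the
  -- identity modulo N x.
  obtain ⟨Δ, w, hwN, hw⟩ := C.exists_enum (s := x.1) (C.mem x.2) (C.index_le x.2)
  have htp := typeOf_eq_of_tp_eq h w fun t y => by
    obtain ⟨rfl, hy⟩ := hwN t y
    rw [hA, hy]
    exact hxF
  obtain ⟨H, hH, hrel⟩ := C.exists_relEnv_of_typeOf_eq hS htp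
  refine ⟨H, hH, hrel _ .zero, fun p hp => ?_⟩
  obtain ⟨y, hy⟩ := hw p.1
  have h₁ : p.2 ∈ C.cos (y.eval w) := (hrel _ y.succ p hp).1 hy
  rw [← (hwN _ y).2]
  exact (C.mem_cos _ hy).1 h₁

/-- A correspondence from a to b moves points only modulo N x. So if d is above x and above a, each
point of N b differs by an element of N d from a point of N a, and d is above b. -/
theorem joinSet_eq_of_tp_eq {A : Set S.Elem} {F₁ : SortedFilter Jsub G}
    (hA : ∀ s (x : S.carrier s), (⟨s, x⟩ : S.Elem) ∈ A ↔ F₁.Mem (C.N x) s.2) (hS : CoSEP Jsub S)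
    {k : ℕ+} {J : Tuple 𝒥} {a b : S.carrier (k, J)}
    (h : tp S A a = tp S A b) : joinSet Jsub S a A = joinSet Jsub S b A := by
  have key : ∀ {a b : S.carrier (k, J)}, tp S A a = tp S A b →
      ∀ x ∈ A, ∀ d : S.Elem, S.le x.2 d.2 → S.le a d.2 → S.le b d.2 := by
    intro a b h x hx d hxd had
    rw [C.le_iff] at hxd had ⊢
    obtain ⟨H, hH, hrel, hmod⟩ := C.exists_rel_of_tp_eq hA hS h hx
    intro n hn
    obtain ⟨g, hg⟩ := hH.2 n
    have h₁ := had ((hrel.mem_N hH hg).2 hn)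
    simpa using (C.N d.2).mul_mem h₁ (hxd (hmod _ hg))
  refine Set.Subset.antisymm (joinSet_subset fun x hx d hd => ?_)
    (joinSet_subset fun x hx d hd => ?_)
  · exact ⟨key h x hx d hd, key h.symm x hx d hd⟩
  · exact ⟨key h.symm x hx d hd, key h x hx d hd⟩

/-! ### The join of an element with a subsystem -/

section Join
variable {A : Set S.Elem} {F₁ : SortedFilter Jsub G} (hF₁ : ∀ N J, F₁.Mem N J → F.Mem N J)
  (hA : ∀ s (x : S.carrier s), (⟨s, x⟩ : S.Elem) ∈ A ↔ F₁.Mem (C.N x) s.2) {k : ℕ+} {J : Tuple 𝒥}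

include hF₁ hA

theorem exists_mem_subsystem {N : Subgroup G} {J : Tuple 𝒥} (h : F₁.Mem N J) :
    ∃ s, ∃ x : S.carrier s, (⟨s, x⟩ : S.Elem) ∈ A ∧ C.N x = N := by
  let m : ℕ+ := ⟨_, Nat.pos_of_ne_zero (F₁.index_ne h)⟩
  obtain ⟨x, hx, -⟩ := C.exists_mem (s := (m, J)) (hF₁ _ _ h) le_rfl 1
  exact ⟨_, x, (hA _ x).2 (by rwa [hx]), hx⟩

/-- Among the joins N a ⊔ N with N from A, whose indices are at most k, take one of largest index.
Intersecting N with another subgroup of A cannot lower the join further, so it is the least. -/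
theorem joinSet_nonempty (a : S.carrier (k, J)) : (joinSet Jsub S a A).Nonempty := by
  obtain ⟨J₁⟩ := F.inhabited
  have : Nonempty {N : Subgroup G // ∃ J, F₁.Mem N J} := ⟨⟨⊤, J₁, F₁.top J₁⟩⟩
  have hfi : ∀ N, (C.N a ⊔ N).index ≠ 0 := fun N => sup_index_ne (C.index_ne a)
  obtain ⟨⟨N₁, J₁, h₁⟩, hmax⟩ := exists_max_of_le
    (fun N : {N : Subgroup G // ∃ J, F₁.Mem N J} => (C.N a ⊔ N).index) k (fun N => by
      have : (C.N a).FiniteIndex := ⟨C.index_ne a⟩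
      exact (Subgroup.index_antitone le_sup_left).trans (C.index_le a))
  obtain ⟨⟨k', J'⟩, x, hxA, rfl⟩ := C.exists_mem_subsystem hF₁ hA h₁
  have hnx := C.normal x
  have hna := C.normal a
  have hup := F.up k (C.mem a) (le_sup_left : C.N a ≤ C.N a ⊔ C.N x) inferInstance (C.index_le a)
  obtain ⟨c, hc, -⟩ := C.exists_mem (s := (k * k', Jsub k J)) hup (by
    have : (C.N x).FiniteIndex := ⟨C.index_ne x⟩
    have h₂ := (Subgroup.index_antitone (le_sup_right : C.N x ≤ C.N a ⊔ C.N x)).trans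
      (C.index_le x)
    refine h₂.trans ?_
    exact_mod_cast Nat.le_mul_of_pos_left _ k.pos) 1
  refine ⟨⟨_, c⟩, k', J', x, hxA, rfl, (C.le_iff _ _).2 ?_, (C.le_iff _ _).2 ?_, ?_⟩
  · rw [hc]; exact le_sup_left
  · rw [hc]; exact le_sup_right
  · rintro ⟨t, y⟩ hy d had hyd
    rw [C.le_iff] at had hyd ⊢
    rw [hc]
    have hyF := (hA t y).1 hy
    have hle : C.N a ⊔ (C.N x ⊓ C.N y) ≤ C.N a ⊔ C.N x := sup_le_sup_left inf_le_left _
    rw [← eq_of_le_of_index_le hle (hfi _) (hmax ⟨_, _, F₁.inf h₁ hyF⟩)]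
    exact sup_le had (inf_le_right.trans hyd)

/-- Minimality is tested against an element d whose subgroup is exactly N a ⊔ N; such a d exists by
upward closure from a. -/
theorem joinSet_spec {a : S.carrier (k, J)} {c : S.Elem} (hc : c ∈ joinSet Jsub S a A) :
    c.1.2 = Jsub k J ∧ C.N a ≤ C.N c.2 ∧ (∃ x ∈ A, C.N c.2 = C.N a ⊔ C.N x.2) ∧
      ∀ N J, F₁.Mem N J → C.N c.2 ≤ C.N a ⊔ N := by
  obtain ⟨k', J', x, hx, hs, hac, hxc, hmin⟩ := hc
  rw [C.le_iff] at hac hxc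
  have hle : ∀ N J, F₁.Mem N J → C.N c.2 ≤ C.N a ⊔ N := by
    intro N J₁ hN
    obtain ⟨t, y, hy, rfl⟩ := C.exists_mem_subsystem hF₁ hA hN
    have hny := C.normal y
    have hna := C.normal a
    have hup := F.up k (C.mem a) (le_sup_left : C.N a ≤ C.N a ⊔ C.N y) inferInstance (C.index_le a)
    let m : ℕ+ := ⟨_, Nat.pos_of_ne_zero (F.index_ne hup)⟩
    obtain ⟨d, hd, -⟩ := C.exists_mem (s := (m, _)) hup le_rfl 1
    have := hmin _ hy ⟨_, d⟩ ((C.le_iff _ _).2 (by rw [hd]; exact le_sup_left))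
      ((C.le_iff _ _).2 (by rw [hd]; exact le_sup_right))
    rwa [C.le_iff, hd] at this
  refine ⟨by rw [hs], hac, ⟨_, hx, le_antisymm ?_ (sup_le hac hxc)⟩, hle⟩
  exact hle _ _ ((hA _ x).1 hx)

/-- Each element of the join is minimal, so all share one subgroup. It is the least subgroup that
`gen_eq` needs, although the join may be an infinite set. -/
theorem joinSet_N_eq {a : S.carrier (k, J)} {c d : S.Elem} (hc : c ∈ joinSet Jsub S a A)
    (hd : d ∈ joinSet Jsub S a A) : C.N c.2 = C.N d.2 := by
  have key : ∀ c d : S.Elem, c ∈ joinSet Jsub S a A → d ∈ joinSet Jsub S a A →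
      C.N c.2 ≤ C.N d.2 := by
    intro c d hc hd
    obtain ⟨-, -, ⟨x, hx, he⟩, -⟩ := C.joinSet_spec hF₁ hA hd
    rw [he]
    exact (C.joinSet_spec hF₁ hA hc).2.2.2 _ _ ((hA _ x.2).1 hx)
  exact le_antisymm (key _ _ hc hd) (key _ _ hd hc)

theorem gen_joinSet_union (a : S.carrier (k, J)) :
    Gen Jsub (C.pairs (joinSet Jsub S a A ∪ {⟨(k, J), a⟩})) (C.N a) J ∧
      ∀ x ∈ joinSet Jsub S a A ∪ {⟨(k, J), a⟩}, C.N a ≤ C.N x.2 := by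
  refine ⟨.base ⟨⟨(k, J), a⟩, Or.inr rfl, rfl, rfl⟩, ?_⟩
  rintro x (hx | rfl)
  · exact (C.joinSet_spec hF₁ hA hx).2.1
  · exact le_rfl

theorem gen_joinSet {a : S.carrier (k, J)} {c : S.Elem} (hc : c ∈ joinSet Jsub S a A) :
    gen Jsub S (joinSet Jsub S a A) =
      {y | Gen Jsub (C.pairs (joinSet Jsub S a A)) (C.N y.2) y.1.2} :=
  C.gen_eq (N₀ := C.N c.2) (J₀ := c.1.2) (.base ⟨c, hc, rfl, rfl⟩)
    fun _ hx => (C.joinSet_N_eq hF₁ hA hc hx).le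

theorem le_of_mem_gen_joinSet {a : S.carrier (k, J)} {c : S.Elem}
    (hc : c ∈ joinSet Jsub S a A) {y : S.Elem} (hy : y ∈ gen Jsub S (joinSet Jsub S a A)) :
    C.N c.2 ≤ C.N y.2 := by
  rw [C.gen_joinSet hF₁ hA hc] at hy
  exact Gen.le (C.pairs_le fun _ hx => (C.joinSet_N_eq hF₁ hA hc hx).le) hy

end Join

/-- Correspondences extend to generated subsystems. -/
theorem exists_rel_gen {X Y : Set S.Elem}
    (hX : gen Jsub S X = {y | Gen Jsub (C.pairs X) (C.N y.2) y.1.2})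
    (hY : gen Jsub S Y = {y | Gen Jsub (C.pairs Y) (C.N y.2) y.1.2})
    {H : Subgroup (G × G)} (hH : BiSurj H)
    (h : ∀ x ∈ X, ∃ y : S.carrier x.1, (⟨x.1, y⟩ : S.Elem) ∈ Y ∧ C.Rel C H x.2 y) (s : Idx 𝒥)
    (x : (S.induce (gen Jsub S X)).carrier s) :
    ∃ y : (S.induce (gen Jsub S Y)).carrier s, C.Rel C H x.1 y.1 := by
  have hx : Gen Jsub (C.pairs X) (C.N x.1) s.2 := by
    have : (⟨s, x.1⟩ : S.Elem) ∈ {y : S.Elem | Gen Jsub (C.pairs X) (C.N y.2) y.1.2} := hX ▸ x.2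
    exact this
  obtain ⟨h₁, h₂⟩ := Gen.corrImage (F' := F.gen (C.pairs_mem Y)) hH (by
    rintro _ _ ⟨z, hz, rfl, rfl⟩
    obtain ⟨y, hy, hr⟩ := h z hz
    refine ⟨fun g => hr.of_one hH, ?_⟩
    rw [hr.corrImage_N hH]
    exact .base ⟨_, hy, rfl, rfl⟩) hx
  obtain ⟨y, hy⟩ := C.exists_rel C hH x.1 h₁ (Gen.mem (C.pairs_mem Y) h₂)
  refine ⟨⟨y, ?_⟩, hy⟩
  rw [hY]
  change Gen Jsub (C.pairs Y) (C.N y) s.2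
  rw [← hy.corrImage_N hH]
  exact h₂

theorem exists_iso_gen {X Y : Set S.Elem}
    (hX : gen Jsub S X = {y | Gen Jsub (C.pairs X) (C.N y.2) y.1.2})
    (hY : gen Jsub S Y = {y | Gen Jsub (C.pairs Y) (C.N y.2) y.1.2})
    {H : Subgroup (G × G)} (hH : BiSurj H)
    (h : ∀ x ∈ X, ∃ y : S.carrier x.1, (⟨x.1, y⟩ : S.Elem) ∈ Y ∧ C.Rel C H x.2 y)
    (h' : ∀ y ∈ Y, ∃ x : S.carrier y.1, (⟨y.1, x⟩ : S.Elem) ∈ X ∧ C.Rel C H x y.2) :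
    ∃ f : Iso (S.induce (gen Jsub S X)) (S.induce (gen Jsub S Y)),
      ∀ s (x : (S.induce (gen Jsub S X)).carrier s), C.Rel C H x.1 (f.toFun s x).1 := by
  have hg : ∀ X : Set S.Elem, gen Jsub S X = {y | Gen Jsub (C.pairs X) (C.N y.2) y.1.2} →
      ∀ s (x : S.carrier s), (⟨s, x⟩ : S.Elem) ∈ gen Jsub S X ↔
        (F.gen (C.pairs_mem X)).Mem (C.N x) s.2 := by
    intro X hX
    rw [hX]
    exact fun _ _ => Iff.rfl
  let D := C.restrict (F.gen (C.pairs_mem X)) (fun _ _ h => Gen.mem (C.pairs_mem X) h) _ (hg X hX)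
  let E := C.restrict (F.gen (C.pairs_mem Y)) (fun _ _ h => Gen.mem (C.pairs_mem Y) h) _ (hg Y hY)
  choose f hf using C.exists_rel_gen hX hY hH h
  have hf' := C.exists_rel_gen hY hX hH.inv fun y hy => by
    obtain ⟨x, hx, hr⟩ := h' y hy
    exact ⟨x, hx, hr.symm⟩
  refine ⟨iso (C := D) (C' := E) hH f hf fun s y => ?_, hf⟩
  obtain ⟨x, hx⟩ := hf' s y
  exact ⟨x, fun p hp => (hx (p.2, p.1) hp).symm⟩

end Coord

/-- The characterization of equality of types over a subsystem. -/
theorem tp_eq_iff {S : Str 𝒥} (hS : IsSCSSEP Jsub S) {A : Set S.Elem} (hA : IsSubsystem Jsub S A)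
    (k : ℕ+) (J : Tuple 𝒥) (a b : S.carrier (k, J)) :
    tp S A a = tp S A b ↔ joinSet Jsub S a A = joinSet Jsub S b A ∧
      ∃ f : Iso (S.induce (gen Jsub S (joinSet Jsub S a A ∪ {⟨(k, J), a⟩})))
          (S.induce (gen Jsub S (joinSet Jsub S b A ∪ {⟨(k, J), b⟩}))),
        (∀ (s : Idx 𝒥) (x : S.carrier s)
          (hx : (⟨s, x⟩ : S.Elem) ∈ gen Jsub S (joinSet Jsub S a A)),
          (f.toFun s ⟨x, gen_mono Jsub S Set.subset_union_left hx⟩).1 = x) ∧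
        (f.toFun (k, J) ⟨a, subset_gen Jsub S _ (Or.inr rfl)⟩).1 = b := by
  obtain ⟨hS₁, hS₂⟩ := hS
  obtain ⟨G, _, F, ⟨C⟩⟩ := hS₁.exists_coord
  obtain ⟨F₁, hF₁, hA'⟩ := C.exists_sortedFilter hA
  obtain ⟨c, hc⟩ := C.joinSet_nonempty hF₁ hA' a
  obtain ⟨ha₁, ha₂⟩ := C.gen_joinSet_union hF₁ hA' a
  obtain ⟨hb₁, hb₂⟩ := C.gen_joinSet_union hF₁ hA' b
  obtain ⟨-, hac, ⟨x₀, hx₀, hcx⟩, hmin⟩ := C.joinSet_spec hF₁ hA' hc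
  constructor
  · intro h
    have hj := C.joinSet_eq_of_tp_eq hA' hS₂ h
    refine ⟨hj, ?_⟩
    obtain ⟨H, hH, hrel, hmod⟩ := C.exists_rel_of_tp_eq hA' hS₂ h hx₀
    -- H is the identity modulo N x₀, and N x₀ lies below N c because x₀ attains the join; so
    -- everything above c is fixed.
    have hself : ∀ s (y : S.carrier s), C.N c.2 ≤ C.N y → C.Rel C H y y := fun s y hy =>
      Coord.Rel.refl_of fun p hp => hy (by rw [hcx]; exact le_sup_right (α := Subgroup G) (hmod p hp))
    have hself' : ∀ x ∈ joinSet Jsub S a A, C.Rel C H x.2 x.2 := fun x hx =>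
      hself _ _ (C.joinSet_N_eq hF₁ hA' hc hx).le
    obtain ⟨f, hf⟩ := C.exists_iso_gen (C.gen_eq ha₁ ha₂) (C.gen_eq hb₁ hb₂) hH (by
      rintro x (hx | rfl)
      · exact ⟨x.2, Or.inl (hj ▸ hx), hself' x hx⟩
      · exact ⟨b, Or.inr rfl, hrel⟩) (by
      rintro x (hx | rfl)
      · exact ⟨x.2, Or.inl (hj ▸ hx), hself' x (hj ▸ hx)⟩
      · exact ⟨a, Or.inr rfl, hrel⟩)
    refine ⟨f, fun s x hx => ?_, ?_⟩
    · have hle := C.le_of_mem_gen_joinSet hF₁ hA' hc hx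
      exact ((hf s ⟨x, _⟩).eq_iff hH (hself s x hle)).2 rfl
    · exact ((hf (k, J) ⟨a, _⟩).eq_iff hH hrel).2 rfl
  · rintro ⟨hj, f, hf, hfa⟩
    obtain ⟨H, hH, hrel⟩ := C.exists_corr_gen C ha₁ ha₂
      { toFun := fun s x => (f.toFun s x).1
        injective := fun s x y h => f.injective s (Subtype.ext h)
        le_iff := fun x y => f.le_iff x y
        C_iff := fun x y => f.C_iff x y
        P_iff := fun x y z => f.P_iff x y z }
    replace hrel : ∀ s (y : (S.induce (gen Jsub S (joinSet Jsub S a A ∪ {⟨(k, J), a⟩}))).carrier s),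
      C.Rel C H y.1 (f.toFun s y).1 := hrel
    have hab : C.Rel C H a b := by
      have := hrel (k, J) ⟨a, subset_gen Jsub S _ (Or.inr rfl)⟩
      rwa [hfa] at this
    -- The isomorphism fixes every coset of N c, since these cosets all lie in the subsystem
    -- generated by the join.
    have hmod : ∀ p ∈ H, p.1⁻¹ * p.2 ∈ C.N c.2 := by
      intro p hp
      obtain ⟨y, hy, hpy⟩ := C.exists_coset c.2 p.1
      have hyg : (⟨c.1, y⟩ : S.Elem) ∈ gen Jsub S (joinSet Jsub S a A) := by
        rw [C.gen_joinSet hF₁ hA' hc]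
        exact .base ⟨c, hc, hy.symm, rfl⟩
      have h₁ := hrel _ ⟨y, gen_mono Jsub S Set.subset_union_left hyg⟩
      rw [hf _ y hyg] at h₁
      rw [← hy]
      exact (C.mem_cos _ hpy).1 ((h₁ p hp).1 hpy)
    have hmin' := (C.joinSet_spec hF₁ hA' (hj ▸ hc : c ∈ joinSet Jsub S b A)).2.2.2
    refine tp_eq_of_typeOf_eq fun Δ w hw => ?_
    obtain ⟨N₁, J₁, h₁, hle⟩ := C.exists_mem_le_nInf w fun s x => (hA' s _).1 (hw s x)
    -- N₁ lies in A and below all the parameters. Minimality of the join for a and for b makes H the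
    -- identity modulo N a ⊔ N₁ and N b ⊔ N₁, as gluing requires.
    obtain ⟨H', hH', hp'⟩ := hH.exists_amalgam (C.normal b) (F₁.normal h₁)
      (fun p hp => hab.mem_N hH hp) (fun p hp => hmin _ _ h₁ (hmod p hp))
      (fun p hp => hmin' _ _ h₁ (hmod p hp))
    refine C.typeOf_eq_of_relEnv hS₂ hH' fun s x => ?_
    cases x with
    | zero =>
      intro p hp
      obtain ⟨-, n, hn, hpn⟩ := hp' p hp
      have h₂ : p.1 ∈ C.cos a ↔ p.2 * n ∈ C.cos b := hab _ hpn
      change p.1 ∈ C.cos a ↔ p.2 ∈ C.cos b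
      rw [h₂]
      constructor <;> intro h₃ <;> refine (C.mem_cos _ h₃).2 ?_
      · simpa using (C.N b).inv_mem hn
      · simpa using hn
    | succ x => exact Coord.Rel.refl_of fun p hp => C.nInf_le w x (hle (hp' p hp).1)

/-! ### Stability -/

/-! ### Subtuples and copies of tuples in `S` -/

section Subtuple
variable {M S : Str 𝒥} {Γ Δ Θ : List (Idx 𝒥)}

/-- `v` and `v'` are subtuples of `u` and `u'` at the same places. -/
def IsSubtuple (u : Env M Θ) (u' : Env S Θ) (v : Env M Γ) (v' : Env S Γ) : Prop :=
  ∀ s (x : Var Γ s), ∃ y : Var Θ s, y.eval u = x.eval v ∧ y.eval u' = x.eval v'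

variable {u : Env M Θ} {u' : Env S Θ} {v : Env M Γ} {v' : Env S Γ} {w : Env M Δ} {w' : Env S Δ}

theorem IsSubtuple.typeOf_eq (h : IsSubtuple u u' v v') (hu : typeOf u = typeOf u') :
    typeOf v = typeOf v' := by
  choose ρ hρ hρ' using h
  exact typeOf_comap hu ρ hρ hρ'

theorem isSubtuple_left : IsSubtuple (v.append w) (v'.append w') v v' :=
  fun _ x => ⟨x.inl, Var.eval_inl _ _ _, Var.eval_inl _ _ _⟩

theorem isSubtuple_right : IsSubtuple (v.append w) (v'.append w') w w' :=
  fun _ x => ⟨Var.inr _ x, Var.eval_inr _ _ _, Var.eval_inr _ _ _⟩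

theorem IsSubtuple.trans (h : IsSubtuple u u' v v') (h' : IsSubtuple v v' w w') :
    IsSubtuple u u' w w' := by
  intro s x
  obtain ⟨y, hy, hy'⟩ := h' s x
  obtain ⟨z, hz, hz'⟩ := h s y
  exact ⟨z, hz.trans hy, hz'.trans hy'⟩

theorem IsSubtuple.append (h : IsSubtuple u u' v v') (h' : IsSubtuple u u' w w') :
    IsSubtuple u u' (v.append w) (v'.append w') := by
  intro s x
  obtain ⟨y, rfl⟩ | ⟨y, rfl⟩ := x.eq_inl_or_inr
  · simp only [Var.eval_inl]
    exact h s y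
  · simp only [Var.eval_inr]
    exact h' s y

theorem Env.exists_append (u : Env M (Γ ++ Δ)) : ∃ (v : Env M Γ) (w : Env M Δ), u = v.append w := by
  refine ⟨Env.ofFun Γ fun _ x => x.inl.eval u, Env.ofFun Δ fun _ x => (Var.inr Γ x).eval u,
    Env.ext fun s x => ?_⟩
  obtain ⟨y, rfl⟩ | ⟨y, rfl⟩ := x.eq_inl_or_inr
  · rw [Var.eval_inl, Var.eval_ofFun]
  · rw [Var.eval_inr, Var.eval_ofFun]

/-- A subtuple of the second tuple at the places of a given subtuple of the first. -/
theorem exists_isSubtuple (u' : Env S Θ) (h : ∀ s (x : Var Γ s), ∃ y : Var Θ s,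
    y.eval u = x.eval v) : ∃ v' : Env S Γ, IsSubtuple u u' v v' := by
  choose ρ hρ using h
  exact ⟨Env.ofFun Γ fun s x => (ρ s x).eval u',
    fun s x => ⟨ρ s x, hρ s x, (Var.eval_ofFun (fun s x => (ρ s x).eval u') x).symm⟩⟩

/-- A model of Th(S) is given without coordinates. Arguments about its tuples are carried out on
copies in S. -/
theorem exists_typeOf_eq (hfin : (Set.range (typeOf : Env S (Γ ++ []) → _)).Finite)
    (h : ∀ σ ∈ Th S, Sentence.Holds M σ) (v : Env M Γ) :
    ∃ v' : Env S Γ, typeOf v = typeOf v' := by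
  obtain ⟨v', hv'⟩ := exists_typeOf_append_eq hfin (typeOf_nil_eq h) v
  exact ⟨v', isSubtuple_left.typeOf_eq hv'.symm⟩

end Subtuple

theorem exists_eventually_eq {α β : Type*} (U : Ultrafilter α) (f : α → β)
    (h : (Set.range f).Finite) : ∃ b, ∀ᶠ a in U, f a = b := by
  obtain ⟨b, -, hb⟩ := Ultrafilter.eq_pure_of_finite_mem (f := U.map f) h
    (Ultrafilter.mem_map.2 (Filter.univ_mem' fun a => Set.mem_range_self a))
  refine ⟨b, ?_⟩
  have : {b} ∈ U.map f := by
    rw [hb]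
    exact rfl
  exact Ultrafilter.mem_map.1 this

/-- A complete type is the limit of tuples along an ultrafilter. -/
theorem IsCompleteType.exists_ultrafilter {M : Str 𝒥} {A : Set M.Elem} {Γ : List (Idx 𝒥)}
    {p : Set (Formula (Param M A) Γ)} (hp : IsCompleteType M A p) :
    ∃ U : Ultrafilter (Env M Γ), ∀ φ, φ ∈ p ↔ ∀ᶠ v in U, φ.Realize (paramVal M A) v := by
  classical
  obtain ⟨hp₁, hp₂⟩ := hp
  obtain ⟨U, hU⟩ := Ultrafilter.exists_ultrafilter_of_finite_inter_nonempty
    ((fun φ : Formula (Param M A) Γ => {v | φ.Realize (paramVal M A) v}) '' p) (by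
      intro T hT
      obtain ⟨q, hq, rfl⟩ := Finset.subset_set_image_iff.1 hT
      obtain ⟨v, hv⟩ := hp₂ q hq q.finite_toSet
      refine ⟨v, ?_⟩
      simpa using hv)
  have hmem : ∀ φ ∈ p, ∀ᶠ v in U, φ.Realize (paramVal M A) v := fun φ h => hU ⟨φ, h, rfl⟩
  refine ⟨U, fun φ => ⟨hmem φ, fun h => ?_⟩⟩
  refine (hp₁ φ).resolve_right fun hn => ?_
  obtain ⟨v, h₁, h₂⟩ := (h.and (hmem _ hn)).exists
  exact h₂ h₁

/-! ### Join indices and covering tuples in `S` -/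

namespace Coord
variable {G : Type u} [Group G] {F : SortedFilter Jsub G} {S : Str 𝒥} (C : Coord F S)
  {Γ Δ : List (Idx 𝒥)}

section RelEnv
variable {C} {H : Subgroup (G × G)} {v v' : Env S Γ} {w w' : Env S Δ}

theorem RelEnv.left (h : C.RelEnv H (v.append w) (v'.append w')) : C.RelEnv H v v' := by
  intro s x
  simpa only [Var.eval_inl] using h s x.inl

theorem RelEnv.right (h : C.RelEnv H (v.append w) (v'.append w')) : C.RelEnv H w w' := by
  intro s x
  simpa only [Var.eval_inr] using h s (Var.inr _ x)

theorem RelEnv.append (h : C.RelEnv H v v') (h' : C.RelEnv H w w') :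
    C.RelEnv H (v.append w) (v'.append w') := by
  intro s x
  obtain ⟨y, rfl⟩ | ⟨y, rfl⟩ := x.eq_inl_or_inr
  · simpa only [Var.eval_inl] using h s y
  · simpa only [Var.eval_inr] using h' s y

end RelEnv

/-- The index of the join of the subgroups of two tuples. -/
noncomputable def joinIndex (v : Env S Γ) (w : Env S Δ) : ℕ := (C.nInf v ⊔ C.nInf w).index

theorem joinIndex_le (v : Env S Γ) (w : Env S Δ) : C.joinIndex v w ≤ (C.nInf v).index := by
  have : (C.nInf v).FiniteIndex := ⟨C.nInf_index_ne v⟩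
  exact Subgroup.index_antitone le_sup_left

/-- A correspondence carries joins to joins and preserves indices. The join index is thus an
invariant of the type and makes sense in every model of Th(S). -/
theorem joinIndex_eq (hS : CoSEP Jsub S) {v v' : Env S Γ} {w w' : Env S Δ}
    (h : typeOf (v.append w) = typeOf (v'.append w')) : C.joinIndex v w = C.joinIndex v' w' := by
  obtain ⟨H, hH, hrel⟩ := C.exists_relEnv_of_typeOf_eq hS h
  have hone : ∀ g, (g, (1 : G)) ∈ H → g ∈ C.nInf v := fun g hg =>
    (hrel.left.mem_nInf hH hg).2 (Subgroup.one_mem _)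
  have hn := C.nInf_normal w
  have hn' := C.nInf_normal w'
  have key : corrImage H (C.nInf v ⊔ C.nInf w) = C.nInf v' ⊔ C.nInf w' := by
    ext k
    rw [mem_corrImage]
    constructor
    · rintro ⟨g, hg, hp⟩
      obtain ⟨n, hn, m, hm, rfl⟩ := Subgroup.mem_sup_of_normal_right.1 hg
      obtain ⟨n', hnn⟩ := hH.1 n
      have h₁ : (m, n'⁻¹ * k) ∈ H := by simpa using H.mul_mem (H.inv_mem hnn) hp
      have h₂ := Subgroup.mul_mem_sup ((hrel.left.mem_nInf hH hnn).1 hn)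
        ((hrel.right.mem_nInf hH h₁).1 hm)
      simpa using h₂
    · intro hk
      obtain ⟨n, hn, m, hm, rfl⟩ := Subgroup.mem_sup_of_normal_right.1 hk
      obtain ⟨n', hnn⟩ := hH.2 n
      obtain ⟨m', hmm⟩ := hH.2 m
      exact ⟨n' * m', Subgroup.mul_mem_sup ((hrel.left.mem_nInf hH hnn).2 hn)
        ((hrel.right.mem_nInf hH hmm).2 hm), H.mul_mem hnn hmm⟩
  rw [joinIndex, joinIndex, ← key,
    hH.corrImage_index fun g hg => (le_sup_left : C.nInf v ≤ _) (hone g hg)]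

/-- The tuple `w` meets all cosets of subgroups below those of the tuple `v`. -/
def Covers (w : Env S Δ) (v : Env S Γ) : Prop :=
  (∀ s (x : Var Δ s), C.N (x.eval w) ≤ C.nInf v) ∧
    ∀ g, ∃ s, ∃ x : Var Δ s, g ∈ C.cos (x.eval w)

theorem exists_covers (v : Env S Γ) : ∃ (Δ : List (Idx 𝒥)) (w : Env S Δ), C.Covers w v := by
  obtain ⟨N₀, J₀, h₀, hle⟩ := C.exists_mem_le_nInf v fun _ _ => C.mem _
  let m : ℕ+ := ⟨_, Nat.pos_of_ne_zero (F.index_ne h₀)⟩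
  obtain ⟨Δ, w, hwN, hw⟩ := C.exists_enum (s := (m, J₀)) h₀ le_rfl
  refine ⟨Δ, w, fun s x => (hwN s x).2.trans_le hle, fun g => ?_⟩
  obtain ⟨x, hx⟩ := hw g
  exact ⟨_, x, hx⟩

variable {C} in
theorem Covers.congr (hS : CoSEP Jsub S) {v v' : Env S Γ} {w w' : Env S Δ} (hc : C.Covers w v)
    (h : typeOf (w.append v) = typeOf (w'.append v')) : C.Covers w' v' := by
  obtain ⟨H, hH, hrel⟩ := C.exists_relEnv_of_typeOf_eq hS h
  constructor
  · intro s x k hk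
    obtain ⟨g, hp⟩ := hH.2 k
    exact (hrel.right.mem_nInf hH hp).1 (hc.1 s x (((hrel.left s x).mem_N hH hp).2 hk))
  · intro k
    obtain ⟨g, hp⟩ := hH.2 k
    obtain ⟨s, x, hx⟩ := hc.2 g
    exact ⟨s, x, (hrel.left s x _ hp).1 hx⟩

variable {C} in
-- Every point lies in an entry of w, which is a coset of a subgroup below `nInf v` and is fixed by
-- H.
theorem Covers.inv_mul_mem {v : Env S Γ} {w : Env S Δ} (hc : C.Covers w v)
    {H : Subgroup (G × G)} (hrel : C.RelEnv H w w) {p : G × G} (hp : p ∈ H) :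
    p.1⁻¹ * p.2 ∈ C.nInf v := by
  obtain ⟨s, x, hx⟩ := hc.2 p.1
  exact hc.1 s x ((C.mem_cos _ hx).1 ((hrel s x p hp).1 hx))

/-- Tuples with the same type over a large enough part of a tuple have the same type over it. -/
theorem typeOf_append_eq (hS : CoSEP Jsub S) {Θ Λ : List (Idx 𝒥)} {v v' : Env S Γ} {w : Env S Δ}
    {α₀ : Env S Θ} {α : Env S Λ} (hw : C.Covers w α₀)
    (h : typeOf (v.append w) = typeOf (v'.append w)) (hα : C.nInf α ≤ C.nInf α₀)
    (hi : C.joinIndex v α = C.joinIndex v α₀) (hi' : C.joinIndex v' α = C.joinIndex v' α₀) :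
    typeOf (v.append α) = typeOf (v'.append α) := by
  -- Equal indices force equal joins. Being the identity modulo the subgroups of α₀ is then enough
  -- to glue with the identity modulo the smaller subgroup of α.
  have hsup : ∀ v : Env S Γ, C.joinIndex v α = C.joinIndex v α₀ →
      C.nInf v ⊔ C.nInf α = C.nInf v ⊔ C.nInf α₀ := fun v hv =>
    eq_of_le_of_index_le (sup_le_sup_left hα _) (sup_index_ne (C.nInf_index_ne v)) hv.le
  obtain ⟨H, hH, hrel⟩ := C.exists_relEnv_of_typeOf_eq hS h
  obtain ⟨H', hH', hp'⟩ := hH.exists_amalgam (C.nInf_normal v') (C.nInf_normal α)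
    (fun p hp => hrel.left.mem_nInf hH hp)
    (fun p hp => by
      rw [hsup v hi]
      exact Subgroup.mem_sup_right (hw.inv_mul_mem hrel.right hp))
    (fun p hp => by
      rw [hsup v' hi']
      exact Subgroup.mem_sup_right (hw.inv_mul_mem hrel.right hp))
  refine C.typeOf_eq_of_relEnv hS hH' (RelEnv.append (fun s x p hp => ?_) fun s x =>
    Rel.refl_of fun p hp => C.nInf_le α x (hp' p hp).1)
  obtain ⟨-, n, hn, hpn⟩ := hp' p hp
  rw [hrel.left s x _ hpn]
  have hn' := C.nInf_le v' x hn
  constructor <;> intro h₃ <;> refine (C.mem_cos _ h₃).2 ?_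
  · simpa using (C.N (x.eval v')).inv_mem hn'
  · simpa using hn'

theorem nInf_le_nInf {Θ : List (Idx 𝒥)} {M : Str 𝒥} {u : Env M Θ} {v : Env M Γ} {u' : Env S Θ}
    {v' : Env S Γ} (h : IsSubtuple u u' v v') : C.nInf u' ≤ C.nInf v' := by
  intro g hg
  refine C.mem_nInf.2 fun s x => ?_
  obtain ⟨y, -, hy⟩ := h s x
  rw [← hy]
  exact C.nInf_le u' y hg

end Coord

theorem exists_var_constEnv {K : Idx 𝒥 → Type u} {M : Str 𝒥} {ι : ∀ s, K s → M.carrier s}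
    {l l' : List (Σ s, K s)} (h : l ⊆ l') (s : Idx 𝒥) (x : Var (l.map Sigma.fst) s) :
    ∃ y : Var (l'.map Sigma.fst) s, y.eval (constEnv ι l') = x.eval (constEnv ι l) := by
  obtain ⟨c, hc, hx⟩ := eval_constEnv_mem ι l x
  obtain ⟨y, hy⟩ := exists_var_of_mem (h hc)
  exact ⟨y, (hy M ι).trans hx.symm⟩

theorem countable_sigma_param {M : Str 𝒥} {A : Set M.Elem} (hA : A.Countable) :
    Countable (Σ s, Param M A s) := by
  have := hA.to_subtype
  refine Function.Injective.countable (β := A) (f := fun c => ⟨⟨c.1, c.2.1⟩, c.2.2⟩) ?_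
  rintro ⟨s, x, hx⟩ ⟨t, y, hy⟩ h
  cases Subtype.mk.inj h
  rfl

/-! ### Counting types over a countable set of parameters -/

section Stable
variable {S : Str 𝒥} (hS : CoSEP Jsub S) {G : Type u} [Group G] {F : SortedFilter Jsub G}
  (C : Coord F S) {M : Str 𝒥} (hM : ∀ σ ∈ Th S, Sentence.Holds M σ) {Γ : List (Idx 𝒥)}

include hS C hM

/-- The index of the join of the subgroups of two tuples of a model of `Th S`. -/
theorem exists_joinIndex : ∃ f : ∀ {Δ : List (Idx 𝒥)}, Env M Γ → Env M Δ → ℕ,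
    ∀ {Δ : List (Idx 𝒥)} (v : Env M Γ) (w : Env M Δ) (v' : Env S Γ) (w' : Env S Δ),
      typeOf (v.append w) = typeOf (v'.append w') → f v w = C.joinIndex v' w' := by
  have key : ∀ {Δ : List (Idx 𝒥)} (v : Env M Γ) (w : Env M Δ), ∃ j,
      ∀ (v' : Env S Γ) (w' : Env S Δ), typeOf (v.append w) = typeOf (v'.append w') →
        j = C.joinIndex v' w' := by
    intro Δ v w
    obtain ⟨u', hu'⟩ := exists_typeOf_eq (C.finite_range_typeOf hS _) hM (v.append w)
    obtain ⟨v', w', rfl⟩ := u'.exists_append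
    exact ⟨_, fun v'' w'' h => C.joinIndex_eq hS (hu'.symm.trans h)⟩
  choose f hf using @key
  exact ⟨f, hf⟩

/-- The limit of the join index along U grows with the list of parameters and is bounded; take a
list where it is largest. -/
theorem exists_joinIndex_stable {A : Set M.Elem}
    {f : ∀ {Δ : List (Idx 𝒥)}, Env M Γ → Env M Δ → ℕ}
    (hf : ∀ {Δ : List (Idx 𝒥)} (v : Env M Γ) (w : Env M Δ) (v' : Env S Γ) (w' : Env S Δ),
      typeOf (v.append w) = typeOf (v'.append w') → f v w = C.joinIndex v' w')
    (U : Ultrafilter (Env M Γ)) :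
    ∃ (l : List (Σ s, Param M A s)) (j : ℕ), ∀ l', l ⊆ l' →
      ∀ᶠ v in U, f v (constEnv (paramVal M A) l') = j := by
  obtain ⟨B, hB⟩ := C.exists_index_nInf_le Γ
  have hcopy : ∀ {Δ : List (Idx 𝒥)} (v : Env M Γ) (w : Env M Δ), ∃ v' w',
      typeOf (v.append w) = typeOf (M := S) (Env.append v' w') := by
    intro Δ v w
    obtain ⟨u', hu'⟩ := exists_typeOf_eq (C.finite_range_typeOf hS _) hM (v.append w)
    obtain ⟨v', w', rfl⟩ := u'.exists_append
    exact ⟨v', w', hu'⟩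
  have hfB : ∀ {Δ : List (Idx 𝒥)} (v : Env M Γ) (w : Env M Δ), f v w ≤ B := by
    intro Δ v w
    obtain ⟨v', w', h⟩ := hcopy v w
    rw [hf v w v' w' h]
    exact (C.joinIndex_le v' w').trans (hB v')
  choose j hj using fun l : List (Σ s, Param M A s) => exists_eventually_eq U
    (fun v => f v (constEnv (paramVal M A) l))
    ((Set.finite_Iic B).subset (by rintro _ ⟨v, rfl⟩; exact hfB _ _))
  obtain ⟨l, hl⟩ := exists_max_of_le j B fun l => by
    obtain ⟨v, hv⟩ := (hj l).exists
    exact hv.symm.trans_le (hfB _ _)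
  refine ⟨l, j l, fun l' hll' => ?_⟩
  have hle : j l ≤ j l' := by
    obtain ⟨v, hv, hv'⟩ := ((hj l).and (hj l')).exists
    rw [← hv, ← hv']
    obtain ⟨v', w', h⟩ := hcopy v (constEnv (paramVal M A) l')
    obtain ⟨w₀, hw₀⟩ := exists_isSubtuple (u := constEnv (paramVal M A) l') w'
      (exists_var_constEnv hll')
    have h₀ := (isSubtuple_left.append (isSubtuple_right.trans hw₀)).typeOf_eq h
    rw [hf _ _ _ _ h, hf _ _ _ _ h₀]
    have : (C.nInf v' ⊔ C.nInf w').FiniteIndex := ⟨sup_index_ne (C.nInf_index_ne v')⟩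
    exact Subgroup.index_antitone (sup_le_sup_left (C.nInf_le_nInf hw₀) _)
  rw [le_antisymm hle (hl l')]
  exact hj l'

/-- A cover of a copy of β in S is brought back to M by matching types. Covering has no direct
meaning in M, so it is expressed through all copies in S. -/
theorem exists_covers_model {Θ : List (Idx 𝒥)} (β : Env M Θ) :
    ∃ (Δ : List (Idx 𝒥)) (w : Env M Δ), ∀ (w' : Env S Δ) (β' : Env S Θ),
      typeOf (w.append β) = typeOf (w'.append β') → C.Covers w' β' := by
  obtain ⟨β₀, hβ₀⟩ := exists_typeOf_eq (C.finite_range_typeOf hS _) hM β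
  obtain ⟨Δ, w₀, hw₀⟩ := C.exists_covers β₀
  obtain ⟨w, hw⟩ := exists_typeOf_append_eq' (C.finite_range_typeOf hS _) hβ₀ w₀
  exact ⟨Δ, w, fun w' β' h => hw₀.congr hS (hw.trans h)⟩

/-- Each complete type gets a finite list l at which the join index has stabilized and a limit type
over the covering tuple `w l`. These two data determine it. -/
theorem countable_types {A : Set M.Elem} (hA : A.Countable) :
    {p : Set (Formula (Param M A) Γ) | IsCompleteType M A p}.Countable := by
  have := countable_sigma_param hA
  obtain ⟨f, hf⟩ := exists_joinIndex hS C hM (Γ := Γ)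
  choose Δ w hw using fun l : List (Σ s, Param M A s) =>
    exists_covers_model hS C hM (constEnv (paramVal M A) l)
  let Q : List (Σ s, Param M A s) → Set (Formula (Param M A) Γ) → Ultrafilter (Env M Γ) → Prop :=
    fun l p U => (∀ φ, φ ∈ p ↔ ∀ᶠ v in U, φ.Realize (paramVal M A) v) ∧
      ∃ j, ∀ l', l ⊆ l' → ∀ᶠ v in U, f v (constEnv (paramVal M A) l') = j
  -- `w l` need not lie in A, so the type of v over it is not decided by p; the ultrafilter decides
  -- it, there being only finitely many possibilities.
  have hτ : ∀ l (U : Ultrafilter (Env M Γ)), 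
      ∃ τ, ∀ᶠ v : Env M Γ in U, typeOf (v.append (w l)) = τ := by
    intro l U
    refine exists_eventually_eq U _ ((C.finite_range_typeOf hS (Γ ++ Δ l)).subset ?_)
    rintro _ ⟨v, rfl⟩
    obtain ⟨u', hu'⟩ := exists_typeOf_eq (C.finite_range_typeOf hS _) hM (v.append (w l))
    exact ⟨u', hu'.symm⟩
  choose τ hτ using hτ
  -- If φ separated p from p', take v satisfying φ and v' refuting it, each with the limiting join
  -- indices at l and at l ++ l₁ and the same type over `w l`. In a common copy in S,
  -- `typeOf_append_eq` gives v and v' the same type over all parameters of φ, a contradiction.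
  have key : ∀ l p p' U U', Q l p U → Q l p' U' → τ l U = τ l U' → p ⊆ p' := by
    rintro l p p' U U' ⟨hU, j, hj⟩ ⟨hU', j', hj'⟩ hττ φ hφ
    by_contra hφ'
    rw [hU'] at hφ'
    obtain ⟨l₁, hl₁⟩ := φ.exists_pure (paramVal M A)
    obtain ⟨ψ, hψ⟩ := hl₁ (l ++ l₁) (List.subset_append_right _ _)
    have hll : l ⊆ l ++ l₁ := List.subset_append_left _ _
    obtain ⟨v, hvφ, hvτ, hv₁, hv₂⟩ := (((hU φ).1 hφ).and ((hτ l U).and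
      ((hj l (List.Subset.refl l)).and (hj _ hll)))).exists
    obtain ⟨v', hvφ', hvτ', hv₁', hv₂'⟩ := ((Ultrafilter.eventually_not.2 hφ').and ((hτ l U').and
      ((hj' l (List.Subset.refl l)).and (hj' _ hll)))).exists
    rw [hψ] at hvφ hvφ'
    generalize hα : constEnv (paramVal M A) (l ++ l₁) = α at *
    obtain ⟨u, hu⟩ := exists_typeOf_eq (C.finite_range_typeOf hS _) hM
      (v.append (v'.append ((w l).append α)))
    obtain ⟨y, u, rfl⟩ := u.exists_append
    obtain ⟨y', u, rfl⟩ := u.exists_append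
    obtain ⟨z, β, rfl⟩ := u.exists_append
    have sv := isSubtuple_left (v := v) (v' := y) (w := v'.append ((w l).append α))
      (w' := y'.append (z.append β))
    have sr := isSubtuple_right (v := v) (v' := y) (w := v'.append ((w l).append α))
      (w' := y'.append (z.append β))
    have sv' := sr.trans isSubtuple_left
    have sr' := sr.trans isSubtuple_right
    have sw := sr'.trans isSubtuple_left
    have sα := sr'.trans isSubtuple_right
    obtain ⟨β₀, sβ⟩ := exists_isSubtuple (u := α) (v := constEnv (paramVal M A) l) β
      (by rw [← hα]; exact exists_var_constEnv hll)
    have sα₀ := sα.trans sβ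
    have h₁ := C.typeOf_append_eq hS (hw l z β₀ ((sw.append sα₀).typeOf_eq hu))
      (((sv.append sw).typeOf_eq hu).symm.trans (hvτ.trans (hττ.trans (hvτ'.symm.trans
        ((sv'.append sw).typeOf_eq hu))))) (C.nInf_le_nInf sβ)
      (by rw [← hf _ _ _ _ ((sv.append sα).typeOf_eq hu),
            ← hf _ _ _ _ ((sv.append sα₀).typeOf_eq hu), hv₁, hv₂])
      (by rw [← hf _ _ _ _ ((sv'.append sα).typeOf_eq hu),
            ← hf _ _ _ _ ((sv'.append sα₀).typeOf_eq hu), hv₁', hv₂'])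
    have h₂ : typeOf (v.append α) = typeOf (v'.append α) :=
      ((sv.append sα).typeOf_eq hu).trans (h₁.trans ((sv'.append sα).typeOf_eq hu).symm)
    have h₃ : ψ ∈ typeOf (v.append α) ↔ ψ ∈ typeOf (v'.append α) := by rw [h₂]
    exact hvφ' (h₃.1 hvφ)
  have hcov : {p : Set (Formula (Param M A) Γ) | IsCompleteType M A p} ⊆
      ⋃ l, {p | ∃ U, Q l p U} := by
    intro p hp
    obtain ⟨U, hU⟩ := IsCompleteType.exists_ultrafilter hp
    obtain ⟨l, hl⟩ := exists_joinIndex_stable hS C hM (A := A) hf U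
    exact Set.mem_iUnion.2 ⟨l, U, hU, hl⟩
  refine (Set.countable_iUnion fun l => Set.Finite.countable ?_).mono hcov
  rcases Set.eq_empty_or_nonempty {p | ∃ U, Q l p U} with he | ⟨-, U₀, -⟩
  · rw [he]
    exact Set.finite_empty
  have : Nonempty (Ultrafilter (Env M Γ)) := ⟨U₀⟩
  choose! U hU using fun p (h : ∃ U, Q l p U) => h
  refine Set.Finite.of_finite_image (f := fun p => τ l (U p))
    ((C.finite_range_typeOf hS (Γ ++ Δ l)).subset ?_) ?_
  · rintro _ ⟨p, -, rfl⟩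
    obtain ⟨v, hv⟩ := (hτ l (U p)).exists
    obtain ⟨u', hu'⟩ := exists_typeOf_eq (C.finite_range_typeOf hS _) hM (v.append (w l))
    exact ⟨u', hu'.symm.trans hv⟩
  · intro p hp p' hp' h
    exact Set.Subset.antisymm (key l p p' _ _ (hU p hp) (hU p' hp') h)
      (key l p' p _ _ (hU p' hp') (hU p hp) h.symm)

end Stable

theorem omegaStable_Th {S : Str 𝒥} (hS : IsSCSSEP Jsub S) : OmegaStable (Th S) := by
  obtain ⟨hS₁, hS₂⟩ := hS
  obtain ⟨G, _, F, ⟨C⟩⟩ := hS₁.exists_coord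
  exact fun M hM A hA Γ => countable_types hS₂ C hM hA

end SortedSystem

theorem mainTheorem3 {𝒥 : Type*} [Countable 𝒥]
    (Jsub : ℕ+ → SortedSystem.Tuple 𝒥 → SortedSystem.Tuple 𝒥)
    (S : SortedSystem.Str 𝒥) (hS : SortedSystem.IsSCSSEP Jsub S) :
    (∀ A : Set S.Elem, SortedSystem.IsSubsystem Jsub S A →
      ∀ (k : ℕ+) (J : SortedSystem.Tuple 𝒥) (a b : S.carrier (k, J)),
        SortedSystem.tp S A a = SortedSystem.tp S A b ↔
          SortedSystem.joinSet Jsub S a A = SortedSystem.joinSet Jsub S b A ∧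
          ∃ f : SortedSystem.Iso
              (S.induce (SortedSystem.gen Jsub S
                (SortedSystem.joinSet Jsub S a A ∪ {⟨(k, J), a⟩})))
              (S.induce (SortedSystem.gen Jsub S
                (SortedSystem.joinSet Jsub S b A ∪ {⟨(k, J), b⟩}))),
            (∀ (s : SortedSystem.Idx 𝒥) (x : S.carrier s)
              (hx : (⟨s, x⟩ : S.Elem) ∈
                SortedSystem.gen Jsub S (SortedSystem.joinSet Jsub S a A)),
              (f.toFun s ⟨x, SortedSystem.gen_mono Jsub S Set.subset_union_left hx⟩).1 = x) ∧
            (f.toFun (k, J) ⟨a, SortedSystem.subset_gen Jsub S _ (Or.inr rfl)⟩).1 = b) ∧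
    SortedSystem.OmegaStable (SortedSystem.Th S) :=
  ⟨fun _ hA k J a b => SortedSystem.tp_eq_iff hS hA k J a b, SortedSystem.omegaStable_Th hS⟩
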